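/- Let $d\ge 2$, write $\lambda_k$ for $k$-dimensional Hausdorff measure on $\mathbb R^d$ (normalized to agree with Lebesgue measure on $k$-dimensional subspaces) and $\omega_k$ for the volume of the Euclidean unit ball of $\mathbb R^k$. A convex body is a compact convex subset of $\mathbb R^d$ with nonempty interior, and the polar of a nonempty set $S$ is $S^\circ=\{y\in\mathbb R^d:\langle x,y\rangle\le 1\ \text{for all }x\in S\}$. For a linear subspace $T$ and a nonempty $S\subseteq T$, put $S^{\circ}_T=\{y\in T:\langle x,y\rangle\le 1\ \text{for all }x\in S\}$. For a convex body $K$ and $x\in\operatorname{int}(K)$, the Funk Finsler ball at $x$ is $B_K(x)=\{v:\|v\|_{K-x}\le 1\}=K-x$, where $\|v\|_{K-x}=\inf\{\lambda>0: v\in\lambda(K-x)\}$. For a convex body $G\subset\operatorname{int}(K)$, the Funk Holmes–Thompson volume of $G$ and the Funk Holmes–Thompson area of $\partial G$ in the geometry of $K$ are $$\mathrm{vol}^F_K(G)=\frac1{\omega_d}\int_G\lambda_d\big(B_K(x)^\circ\big)\,d\lambda_d(x),\qquad \mathrm{area}^F_K(G)=\frac1{\omega_{d-1}}\int_{\partial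 G}\lambda_{d-1}\big((B_K(x)\cap T_x)^\circ_{T_x}\big)\,d\lambda_{d-1}(x),$$ where the second integral is over the smooth points $x$ of $\partial G$ (those with a unique outer unit normal, which form a set of full $\lambda_{d-1}$-measure in $\partial G$), and $T_x$ is the linear hyperplane orthogonal to the outer unit normal of $G$ at $x$. Lemma (Duality of Funk Holmes–Thompson measures). Let $G$ and $K$ be convex bodies in $\mathbb R^d$ with $O\in\operatorname{int}(G)$ and $G\subset\operatorname{int}(K)$. Then (i) $\mathrm{vol}^F_K(G)=\mathrm{vol}^F_{G^\circ}(K^\circ)$, and (ii) $\mathrm{area}^F_K(G)=\mathrm{area}^F_{G^\circ}(K^\circ)$. -/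

import Mathlib

open MeasureTheory Set
open scoped ENNReal RealInnerProductSpace Pointwise

noncomputable section

namespace HolmesThompson

/-- Euclidean space `ℝ^d` with its standard inner product. -/
abbrev E (d : ℕ) : Type := EuclideanSpace ℝ (Fin d)

/-- A convex body: a compact convex set with nonempty interior. -/
structure IsConvexBody {d : ℕ} (K : Set (E d)) : Prop where
  isCompact : IsCompact K
  convex : Convex ℝ K
  nonempty_interior : (interior K).Nonempty

/-- The polar of `S` inside the linear subspace `T`:
`{y ∈ T : ⟪x, y⟫ ≤ 1 for all x ∈ S}`. -/
def polarIn {d : ℕ} (T : Submodule ℝ (E d)) (S : Set (E d)) : Set (E d) :=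
  {y | y ∈ T ∧ ∀ x ∈ S, ⟪x, y⟫ ≤ 1}

/-- The polar `S° = {y : ⟪x, y⟫ ≤ 1 for all x ∈ S}`. -/
def polarBody {d : ℕ} (S : Set (E d)) : Set (E d) :=
  {y | ∀ x ∈ S, ⟪x, y⟫ ≤ 1}

/-- `ω_k`, the `k`-dimensional volume of the Euclidean unit ball of `ℝ^k`. -/
def unitBallVolume (k : ℕ) : ℝ≥0∞ :=
  volume (Metric.closedBall (0 : E k) 1)

/-- `u` is an outer unit normal of `K` at `x`. -/
def IsOuterUnitNormal {d : ℕ} (K : Set (E d)) (x u : E d) : Prop :=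
  ‖u‖ = 1 ∧ ∀ z ∈ K, ⟪u, z - x⟫ ≤ 0

/-- The smooth boundary points of `K`: those with exactly one outer unit normal. -/
def smoothBoundary {d : ℕ} (K : Set (E d)) : Set (E d) :=
  {x | x ∈ frontier K ∧ ∃! u, IsOuterUnitNormal K x u}

open Classical in
/-- The outer unit normal of `K` at a smooth boundary point (and `0` at every other point). -/
def outerNormal {d : ℕ} (K : Set (E d)) (x : E d) : E d :=
  if h : x ∈ smoothBoundary K then h.2.choose else 0

/-- The tangent space of `∂K` at a smooth boundary point `x`, as a linear hyperplane. -/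
def tangentSpace {d : ℕ} (K : Set (E d)) (x : E d) : Submodule ℝ (E d) :=
  (Submodule.span ℝ {outerNormal K x})ᗮ

/-- The Holmes–Thompson volume density `λ_d(D°) / ω_d` of a Finsler ball `D`. -/
def volumeDensity {d : ℕ} (D : Set (E d)) : ℝ≥0∞ :=
  volume (polarBody D) / unitBallVolume d

/-- The Holmes–Thompson area density `λ_{d-1}((D ∩ T)°_T) / ω_{d-1}` of a Finsler ball `D` along
a tangent hyperplane `T`. Here `λ_{d-1} = μHE[d - 1]` is Hausdorff measure on `ℝ^d`, normalized to
agree with Lebesgue measure on `(d-1)`-dimensional subspaces. -/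
def areaDensity {d : ℕ} (D : Set (E d)) (T : Submodule ℝ (E d)) : ℝ≥0∞ :=
  μHE[d - 1] (polarIn T (D ∩ T)) / unitBallVolume (d - 1)

/-- The Funk Finsler structure `F_K(x, v) = ‖v‖_{K - x}` (gauge of the translate `K - x`). -/
def funkFinsler {d : ℕ} (K : Set (E d)) (x v : E d) : ℝ :=
  gauge ((fun z => z - x) '' K) v

/-- The Funk Finsler ball at `x`, the closed unit ball of `F_K(x, ·)`. -/
def funkBall {d : ℕ} (K : Set (E d)) (x : E d) : Set (E d) :=
  {v | funkFinsler K x v ≤ 1}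

/-- The Holmes–Thompson volume of `U` in the Funk geometry of `K`. -/
def funkVolume {d : ℕ} (K U : Set (E d)) : ℝ≥0∞ :=
  ∫⁻ x in U, volumeDensity (funkBall K x)

/-- The Holmes–Thompson `(d-1)`-area, in the Funk geometry of `K`, of the boundary of a convex
body `G`. The density is integrated over the smooth boundary points of `G` with respect to
`(d-1)`-dimensional Hausdorff measure. -/
def funkArea {d : ℕ} (K G : Set (E d)) : ℝ≥0∞ :=
  ∫⁻ x in smoothBoundary G, areaDensity (funkBall K x) (tangentSpace G x) ∂μHE[d - 1]

end HolmesThompson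

end

namespace HolmesThompson

open Metric Filter Topology

variable {d : ℕ}

/-! Write h_A for `supp A`. Both quantities become double integrals over pairs of directions (φ, θ)
that are unchanged when the two directions and the functions h_{G°}, h_K are exchanged. Passing from
(K, G) to (G°, K°) makes exactly this exchange, because K°° = K.

Volume. The polar of K - x is the unit ball of h_K - ⟪x, ·⟫, so d times its volume is ∫ (h_K(θ) -
⟪x, θ⟫)^{-d} dθ. Since h_{G°} is the gauge of G, put x = rφ with r ≤ 1/h_{G°}(φ) and substitute r =
h_K(θ)ρ. The radial integral then depends only on ⟪φ, θ⟫ and the product h_{G°}(φ) h_K(θ)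
(`lintegral_eq_radialKernel`, `funkVolume_eq`).

Area. At a smooth boundary point x the gradient p = ∇h_{G°}(x) satisfies ⟪p, x⟫ = 1 and is normal to
G. The polar of a hyperplane section is a projection of the polar, and a Cauchy-type formula gives 2
λ_{d-1} of it as ∫ |⟪∇h_A(θ), n⟫| h_A(θ)^{-d} dθ (`two_mul_area_polarIn_section`). For A = K - x and
n = p/‖p‖ the first factor is |⟪∇h_K(θ), p⟫ - 1| / ‖p‖. The weight 1/‖p‖ is the distance of the
tangent plane from the origin, and with this weight surface measure is cone measure
(`coneMeasure_eq_weightedSurfaceMeasure`), which is h_{G°}(φ)^{-d} dφ in directions. The integrand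
becomes |⟪∇h_K(θ), ∇h_{G°}(φ)⟫ - 1| (h_{G°}(φ) h_K(θ) - ⟪φ, θ⟫)^{-d}, again symmetric
(`funkArea_eq`). -/

/-- The support function `w ↦ sup_{a ∈ A} ⟪a, w⟫` of `A`. -/
noncomputable def supp (A : Set (E d)) (w : E d) : ℝ := sSup ((fun a => ⟪a, w⟫) '' A)

/-! ### Support functions, polars and the bipolar theorem. -/

section Support

variable {A : Set (E d)}

lemma bddAbove_inner_image (hA : IsCompact A) (w : E d) :
    BddAbove ((fun a => ⟪a, w⟫) '' A) :=
  (hA.image (by fun_prop)).bddAbove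

lemma inner_le_supp (hA : IsCompact A) {a : E d} (ha : a ∈ A) (w : E d) :
    ⟪a, w⟫ ≤ supp A w :=
  le_csSup (bddAbove_inner_image hA w) ⟨a, ha, rfl⟩

lemma exists_inner_eq_supp (hA : IsCompact A) (hne : A.Nonempty) (w : E d) :
    ∃ a ∈ A, ⟪a, w⟫ = supp A w :=
  (hA.image (f := fun a => ⟪a, w⟫) (by fun_prop)).sSup_mem (hne.image _)

lemma supp_le_iff (hA : IsCompact A) (hne : A.Nonempty) {w : E d} {c : ℝ} :
    supp A w ≤ c ↔ ∀ a ∈ A, ⟪a, w⟫ ≤ c := by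
  constructor
  · exact fun h a ha => (inner_le_supp hA ha w).trans h
  · intro h
    obtain ⟨a, ha, e⟩ := exists_inner_eq_supp hA hne w
    exact e ▸ h a ha

lemma polarBody_eq_supp_le (hA : IsCompact A) (hne : A.Nonempty) :
    polarBody A = {w | supp A w ≤ 1} := by
  ext w
  exact (supp_le_iff hA hne).symm

lemma supp_smul (hA : IsCompact A) (hne : A.Nonempty) {t : ℝ} (ht : 0 ≤ t) (w : E d) :
    supp A (t • w) = t * supp A w := by
  apply le_antisymm
  · rw [supp_le_iff hA hne]
    intro a ha
    rw [inner_smul_right]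
    exact mul_le_mul_of_nonneg_left (inner_le_supp hA ha w) ht
  · obtain ⟨a, ha, e⟩ := exists_inner_eq_supp hA hne w
    rw [← e, ← inner_smul_right]
    exact inner_le_supp hA ha _

lemma supp_zero (hA : IsCompact A) (hne : A.Nonempty) : supp A 0 = 0 := by
  simpa using supp_smul hA hne le_rfl 0

lemma supp_add_le (hA : IsCompact A) (hne : A.Nonempty) (v w : E d) :
    supp A (v + w) ≤ supp A v + supp A w := by
  rw [supp_le_iff hA hne]
  intro a ha
  rw [inner_add_right]
  exact add_le_add (inner_le_supp hA ha v) (inner_le_supp hA ha w)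

lemma convexOn_supp (hA : IsCompact A) (hne : A.Nonempty) : ConvexOn ℝ univ (supp A) := by
  refine ⟨convex_univ, fun x _ y _ a b ha hb _ => ?_⟩
  refine (supp_add_le hA hne _ _).trans ?_
  rw [supp_smul hA hne ha, supp_smul hA hne hb, smul_eq_mul, smul_eq_mul]

lemma supp_le_mul_norm (hA : IsCompact A) (hne : A.Nonempty) {R : ℝ}
    (hR : ∀ a ∈ A, ‖a‖ ≤ R) (w : E d) : supp A w ≤ R * ‖w‖ := by
  rw [supp_le_iff hA hne]
  intro a ha
  exact (real_inner_le_norm a w).trans (mul_le_mul_of_nonneg_right (hR a ha) (norm_nonneg _))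

/-- Subadditivity bounds the increment by h_A(x - y), and a norm bound for `A` bounds that. This is
what makes Rademacher's theorem available. -/
lemma exists_lipschitzWith_supp (hA : IsCompact A) (hne : A.Nonempty) :
    ∃ C, LipschitzWith C (supp A) := by
  obtain ⟨R, hR⟩ := hA.isBounded.exists_norm_le
  refine ⟨R.toNNReal, LipschitzWith.of_le_add_mul _ fun x y => ?_⟩
  have h1 := supp_add_le hA hne y (x - y)
  have h2 := supp_le_mul_norm hA hne hR (x - y)
  rw [add_sub_cancel] at h1
  have h3 : R * ‖x - y‖ ≤ (R.toNNReal : ℝ) * ‖x - y‖ :=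
    mul_le_mul_of_nonneg_right (Real.le_coe_toNNReal R) (norm_nonneg _)
  rw [dist_eq_norm]
  linarith

lemma continuous_supp (hA : IsCompact A) (hne : A.Nonempty) : Continuous (supp A) :=
  (exists_lipschitzWith_supp hA hne).choose_spec.continuous

/-- If `0` is interior to `A`, the support function of `A` dominates a multiple of the norm. -/
lemma exists_mul_norm_le_supp (hA : IsCompact A) (h0 : 0 ∈ interior A) :
    ∃ r > 0, ∀ w, r * ‖w‖ ≤ supp A w := by
  obtain ⟨r, hr, hsub⟩ := Metric.mem_nhds_iff.1 (mem_interior_iff_mem_nhds.1 h0)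
  refine ⟨r / 2, by positivity, fun w => ?_⟩
  rcases eq_or_ne w 0 with rfl | hw
  · simp [supp_zero hA ⟨0, interior_subset h0⟩]
  have hw' : 0 < ‖w‖ := norm_pos_iff.2 hw
  have hmem : (r / 2 / ‖w‖) • w ∈ A := by
    apply hsub
    rw [mem_ball_zero_iff, norm_smul, Real.norm_of_nonneg (by positivity),
      div_mul_cancel₀ _ hw'.ne']
    linarith
  have := inner_le_supp hA hmem w
  rwa [real_inner_smul_left, real_inner_self_eq_norm_sq, div_mul_eq_mul_div,
    div_le_iff₀ hw', pow_two, ← mul_assoc, mul_le_mul_iff_left₀ hw'] at this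

lemma supp_nonneg (hA : IsCompact A) (h0 : 0 ∈ A) (w : E d) : 0 ≤ supp A w := by
  simpa using inner_le_supp hA h0 w

lemma supp_pos (hA : IsCompact A) (h0 : 0 ∈ interior A) {w : E d} (hw : w ≠ 0) :
    0 < supp A w := by
  obtain ⟨r, hr, h⟩ := exists_mul_norm_le_supp hA h0
  exact (mul_pos hr (norm_pos_iff.2 hw)).trans_le (h w)

lemma isClosed_polarBody (A : Set (E d)) : IsClosed (polarBody A) := by
  simp only [polarBody, ofPred_forall]
  exact isClosed_biInter fun x _ => isClosed_le (by fun_prop) continuous_const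

lemma convex_polarBody (A : Set (E d)) : Convex ℝ (polarBody A) := by
  intro x hx y hy a b ha hb hab z hz
  rw [inner_add_right, inner_smul_right, inner_smul_right]
  have h1 := mul_le_mul_of_nonneg_left (hx z hz) ha
  have h2 := mul_le_mul_of_nonneg_left (hy z hz) hb
  linarith

lemma zero_mem_polarBody (A : Set (E d)) : 0 ∈ polarBody A := fun x _ => by simp

lemma isCompact_polarBody (hA : IsCompact A) (h0 : 0 ∈ interior A) :
    IsCompact (polarBody A) := by
  obtain ⟨r, hr, h⟩ := exists_mul_norm_le_supp hA h0
  refine Metric.isCompact_of_isClosed_isBounded (isClosed_polarBody A)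
    ((isBounded_iff_forall_norm_le).2 ⟨1 / r, fun w hw => ?_⟩)
  rw [polarBody_eq_supp_le hA ⟨0, interior_subset h0⟩] at hw
  rw [le_div_iff₀' hr]
  exact (h w).trans hw

lemma zero_mem_interior_polarBody (hA : IsCompact A) (hne : A.Nonempty) :
    0 ∈ interior (polarBody A) := by
  rw [polarBody_eq_supp_le hA hne]
  refine interior_mono (s := {w | supp A w < 1}) (fun w hw => (show supp A w < 1 from hw).le) ?_
  rw [(isOpen_lt (continuous_supp hA hne) continuous_const).interior_eq]
  simp [supp_zero hA hne]

/-- A convex body whose interior contains the origin has a polar of the same kind. -/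
lemma IsConvexBody.polarBody (hA : IsConvexBody A) (h0 : 0 ∈ interior A) :
    IsConvexBody (polarBody A) where
  isCompact := isCompact_polarBody hA.isCompact h0
  convex := convex_polarBody A
  nonempty_interior := ⟨0, zero_mem_interior_polarBody hA.isCompact ⟨0, interior_subset h0⟩⟩

/-- A point outside a closed convex set containing the origin is separated from it by a
functional bounded by `1` on the set. -/
lemma exists_polarBody_one_lt_inner (hc : IsClosed A) (hconv : Convex ℝ A) (h0 : 0 ∈ A)
    {x : E d} (hx : x ∉ A) : ∃ w ∈ polarBody A, 1 < ⟪x, w⟫ := by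
  obtain ⟨f, u, hu, hfx⟩ := geometric_hahn_banach_closed_point hconv hc hx
  have hu0 : 0 < u := by simpa using hu 0 h0
  set v := (InnerProductSpace.toDual ℝ (E d)).symm f with hv
  have hfv : ∀ z, f z = ⟪z, v⟫ := fun z => by
    rw [real_inner_comm, hv, InnerProductSpace.toDual_symm_apply]
  refine ⟨u⁻¹ • v, fun z hz => ?_, ?_⟩
  · rw [inner_smul_right, ← hfv, inv_mul_le_iff₀ hu0, mul_one]
    exact (hu z hz).le
  · rw [inner_smul_right, ← hfv, lt_inv_mul_iff₀ hu0, mul_one]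
    exact hfx

/-- The bipolar theorem. -/
lemma polarBody_polarBody (hc : IsClosed A) (hconv : Convex ℝ A) (h0 : 0 ∈ A) :
    polarBody (polarBody A) = A := by
  ext x
  constructor
  · intro hx
    by_contra hxA
    obtain ⟨w, hw, h1⟩ := exists_polarBody_one_lt_inner hc hconv h0 hxA
    have := hx w hw
    rw [real_inner_comm] at this
    linarith
  · intro hx w hw
    rw [real_inner_comm]
    exact hw x hx

end Support

/-! ### Gradients of support functions as unique maximizers. -/

section Gradient

variable {A : Set (E d)}

/-- At a point of differentiability, the support function attains its maximum only at its
gradient. -/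
lemma eq_gradient_of_inner_eq_supp (hA : IsCompact A) {x p : E d}
    (hd : DifferentiableAt ℝ (supp A) x) (hp : p ∈ A) (hpx : ⟪p, x⟫ = supp A x) :
    p = gradient (supp A) x := by
  -- The difference is nonnegative everywhere and vanishes at x, so its derivative at x is zero.
  have hmin : IsLocalMin (fun v => supp A v - ⟪p, v⟫) x :=
    Eventually.of_forall fun v => by
      have := inner_le_supp hA hp v
      simp only [hpx, sub_self]
      linarith
  have h1 : HasFDerivAt (fun v => supp A v - ⟪p, v⟫) (fderiv ℝ (supp A) x - innerSL ℝ p) x :=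
    hd.hasFDerivAt.sub (innerSL ℝ p).hasFDerivAt
  have h2 := hmin.hasFDerivAt_eq_zero h1
  apply ext_inner_right ℝ
  intro v
  rw [gradient, InnerProductSpace.toDual_symm_apply]
  have h3 := congrArg (fun L : E d →L[ℝ] ℝ => L v) h2
  simp only [_root_.sub_apply, innerSL_apply_apply,
    _root_.zero_apply] at h3
  linarith

lemma gradient_supp_mem (hA : IsCompact A) (hne : A.Nonempty) {x : E d}
    (hd : DifferentiableAt ℝ (supp A) x) : gradient (supp A) x ∈ A := by
  obtain ⟨p, hp, e⟩ := exists_inner_eq_supp hA hne x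
  exact eq_gradient_of_inner_eq_supp hA hd hp e ▸ hp

lemma inner_gradient_supp (hA : IsCompact A) (hne : A.Nonempty) {x : E d}
    (hd : DifferentiableAt ℝ (supp A) x) : ⟪gradient (supp A) x, x⟫ = supp A x := by
  obtain ⟨p, hp, e⟩ := exists_inner_eq_supp hA hne x
  exact eq_gradient_of_inner_eq_supp hA hd hp e ▸ e

/-- A support function is differentiable wherever its maximizer is unique. -/
lemma differentiableAt_supp_of_unique (hA : IsCompact A) (hne : A.Nonempty) {x p : E d}
    (hp : p ∈ A) (hu : ∀ q ∈ A, ⟪q, x⟫ = supp A x → q = p) :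
    DifferentiableAt ℝ (supp A) x := by
  have hpx : ⟪p, x⟫ = supp A x := by
    obtain ⟨q, hq, e⟩ := exists_inner_eq_supp hA hne x
    exact hu q hq e ▸ e
  choose m hm hmx using exists_inner_eq_supp hA hne
  -- Maximizers at v converge to p as v → x: by compactness it suffices to treat cluster points, and
  -- each of these is a maximizer at x because the maximizing relation is closed.
  have hcont : Tendsto m (𝓝 x) (𝓝 p) := by
    apply hA.tendsto_nhds_of_unique_mapClusterPt (Eventually.of_forall hm)
    intro q hq hcl
    apply hu q hq
    apply le_antisymm (inner_le_supp hA hq x)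
    have hclosed : IsClosed {z : E d × E d | supp A z.2 ≤ ⟪z.1, z.2⟫} :=
      isClosed_le ((continuous_supp hA hne).comp continuous_snd) (by fun_prop)
    have h2 : MapClusterPt (q, x) (𝓝 x) (fun v => (m v, v)) := by
      rw [mapClusterPt_iff_ultrafilter] at hcl ⊢
      obtain ⟨U, hU, hq⟩ := hcl
      exact ⟨U, hU, hq.prodMk_nhds hU⟩
    exact hclosed.mem_of_mapClusterPt h2 (Eventually.of_forall fun v => (hmx v).ge)
  refine (HasFDerivAt.of_isLittleO (f' := innerSL ℝ p) ?_).differentiableAt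
  rw [Asymptotics.isLittleO_iff]
  intro c hc
  filter_upwards [hcont (Metric.closedBall_mem_nhds p hc)] with v hv
  -- The remainder is at most ⟪m v - p, v - x⟫, since `m v` competes in the supremum at x.
  have h1 : supp A v - supp A x - ⟪p, v - x⟫ ≤ c * ‖v - x‖ := by
    have e1 := inner_le_supp hA (hm v) x
    have e2 := real_inner_le_norm (m v - p) (v - x)
    have e3 : ‖m v - p‖ ≤ c := by simpa [dist_eq_norm] using hv
    have e4 := mul_le_mul_of_nonneg_right e3 (norm_nonneg (v - x))
    have e5 : ⟪m v - p, v - x⟫ = ⟪m v, v⟫ - ⟪m v, x⟫ - ⟪p, v - x⟫ := by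
      rw [inner_sub_left, inner_sub_right]
    rw [hmx v] at e5
    linarith
  have h2 : 0 ≤ supp A v - supp A x - ⟪p, v - x⟫ := by
    have := inner_le_supp hA hp v
    rw [inner_sub_right, hpx]
    linarith
  rw [innerSL_apply_apply, Real.norm_of_nonneg h2]
  exact h1

lemma measurable_gradient (f : E d → ℝ) : Measurable (gradient f) :=
  (InnerProductSpace.toDual ℝ (E d)).symm.continuous.measurable.comp (measurable_fderiv ℝ f)

lemma differentiableAt_supp_smul (hA : IsCompact A) (hne : A.Nonempty) {x : E d} {t : ℝ}
    (ht : 0 < t) (hd : DifferentiableAt ℝ (supp A) x) : DifferentiableAt ℝ (supp A) (t • x) := by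
  refine differentiableAt_supp_of_unique hA hne (gradient_supp_mem hA hne hd) fun q hq e => ?_
  apply eq_gradient_of_inner_eq_supp hA hd hq
  rw [inner_smul_right, supp_smul hA hne ht.le] at e
  exact mul_left_cancel₀ ht.ne' e

lemma differentiableAt_supp_smul_iff (hA : IsCompact A) (hne : A.Nonempty) {x : E d} {t : ℝ}
    (ht : 0 < t) : DifferentiableAt ℝ (supp A) (t • x) ↔ DifferentiableAt ℝ (supp A) x := by
  refine ⟨fun h => ?_, differentiableAt_supp_smul hA hne ht⟩
  simpa [smul_smul, inv_mul_cancel₀ ht.ne'] using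
    differentiableAt_supp_smul hA hne (inv_pos.2 ht) h

/-- The gradient of a support function is positively homogeneous of degree `0`. -/
lemma gradient_supp_smul (hA : IsCompact A) (hne : A.Nonempty) {t : ℝ} (ht : 0 < t) (x : E d) :
    gradient (supp A) (t • x) = gradient (supp A) x := by
  by_cases hd : DifferentiableAt ℝ (supp A) x
  · refine (eq_gradient_of_inner_eq_supp hA (differentiableAt_supp_smul hA hne ht hd)
      (gradient_supp_mem hA hne hd) ?_).symm
    rw [inner_smul_right, supp_smul hA hne ht.le, inner_gradient_supp hA hne hd]
  -- Where differentiability fails, it fails along the whole ray, and both gradients take the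
  -- default value 0.
  · have hd' : ¬ DifferentiableAt ℝ (supp A) (t • x) := by
      rwa [differentiableAt_supp_smul_iff hA hne ht]
    rw [gradient_eq_zero_of_not_differentiableAt hd, gradient_eq_zero_of_not_differentiableAt hd']

end Gradient

/-! ### The boundary of G as a level set of h_{G°}, and its normals. -/

section Boundary

variable {G : Set (E d)}

/-- By the bipolar theorem, h_{G°} is the gauge of `G`. -/
lemma mem_iff_supp_polarBody_le (hG : IsConvexBody G) (h0 : 0 ∈ interior G) {x : E d} :
    x ∈ G ↔ supp (polarBody G) x ≤ 1 := by
  conv_lhs => rw [← polarBody_polarBody hG.isCompact.isClosed hG.convex (interior_subset h0)]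
  rw [polarBody_eq_supp_le (isCompact_polarBody hG.isCompact h0) ⟨0, zero_mem_polarBody G⟩]
  rfl

/-- An interior point can be dilated by some t > 1 inside `G`, and then homogeneity gives t
h_{G°}(x) ≤ 1. -/
lemma supp_polarBody_lt_one_of_mem_interior (hG : IsConvexBody G) (h0 : 0 ∈ interior G)
    {x : E d} (hx : x ∈ interior G) : supp (polarBody G) x < 1 := by
  have hc := isCompact_polarBody hG.isCompact h0
  have hne : (polarBody G).Nonempty := ⟨0, zero_mem_polarBody G⟩
  have hcont : ContinuousAt (fun t : ℝ => t • x) 1 := by fun_prop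
  have hnhds : ∀ᶠ t in 𝓝 (1 : ℝ), t • x ∈ G := by
    apply hcont
    simpa using mem_interior_iff_mem_nhds.1 hx
  have := (hnhds.filter_mono (nhdsWithin_le_nhds (s := Ioi 1))).and self_mem_nhdsWithin
  obtain ⟨t, ht, ht1⟩ := this.exists
  have ht1' : 1 < t := ht1
  rw [mem_iff_supp_polarBody_le hG h0, supp_smul hc hne (by linarith)] at ht
  by_contra! hcon
  nlinarith

lemma mem_frontier_iff_supp_polarBody (hG : IsConvexBody G) (h0 : 0 ∈ interior G) {x : E d} :
    x ∈ frontier G ↔ supp (polarBody G) x = 1 := by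
  have hc := isCompact_polarBody hG.isCompact h0
  have hne : (polarBody G).Nonempty := ⟨0, zero_mem_polarBody G⟩
  rw [hG.isCompact.isClosed.frontier_eq, Set.mem_sdiff, mem_iff_supp_polarBody_le hG h0]
  constructor
  · rintro ⟨h1, h2⟩
    refine le_antisymm h1 ?_
    by_contra! hcon
    apply h2
    refine interior_maximal (t := {x | supp (polarBody G) x < 1}) (fun y hy => ?_)
      (isOpen_lt (continuous_supp hc hne) continuous_const) hcon
    exact (mem_iff_supp_polarBody_le hG h0).2 (show supp (polarBody G) y < 1 from hy).le
  · exact fun h => ⟨h.le, fun hx =>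
      (supp_polarBody_lt_one_of_mem_interior hG h0 hx).ne h⟩

/-- Outer unit normals at a boundary point are the normalized maximizers of the polar body. -/
lemma isOuterUnitNormal_iff (hG : IsConvexBody G) (h0 : 0 ∈ interior G) {x u : E d}
    (hx : supp (polarBody G) x = 1) :
    IsOuterUnitNormal G x u ↔ ∃ p ∈ polarBody G, ⟪p, x⟫ = 1 ∧ u = ‖p‖⁻¹ • p := by
  have hxG : x ∈ G := (mem_iff_supp_polarBody_le hG h0).2 hx.le
  constructor
  · rintro ⟨hu, hn⟩
    have hle : ∀ z ∈ G, ⟪z, u⟫ ≤ ⟪x, u⟫ := fun z hz => by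
      have := hn z hz
      rw [real_inner_comm, inner_sub_left] at this
      linarith
    have hu0 : u ≠ 0 := fun h => by simp [h] at hu
    have hpos : 0 < ⟪x, u⟫ := by
      have h1 := supp_pos hG.isCompact h0 hu0
      obtain ⟨a, ha, e⟩ := exists_inner_eq_supp hG.isCompact ⟨x, hxG⟩ u
      linarith [hle a ha]
    -- The normal is rescaled so that its supporting hyperplane becomes {⟪p, ·⟫ = 1}, which puts p
    -- in the polar.
    refine ⟨⟪x, u⟫⁻¹ • u, fun z hz => ?_, ?_, ?_⟩
    · rw [inner_smul_right, inv_mul_le_iff₀ hpos, mul_one]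
      exact hle z hz
    · rw [real_inner_smul_left, real_inner_comm x u, inv_mul_cancel₀ hpos.ne']
    · rw [norm_smul, hu, norm_inv, Real.norm_of_nonneg hpos.le, mul_one, inv_inv, smul_smul,
        mul_inv_cancel₀ hpos.ne', one_smul]
  · rintro ⟨p, hp, hpx, rfl⟩
    have hp0 : p ≠ 0 := fun h => by simp [h] at hpx
    refine ⟨by rw [norm_smul, norm_inv, norm_norm, inv_mul_cancel₀ (norm_ne_zero_iff.2 hp0)],
      fun z hz => ?_⟩
    rw [real_inner_smul_left, inner_sub_right, hpx]
    have := hp z hz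
    rw [real_inner_comm] at this
    exact mul_nonpos_of_nonneg_of_nonpos (by positivity) (by linarith)

/-- Unit normals at x correspond to maximizers of ⟪·, x⟫ over G°; uniqueness of the maximizer is the
same as differentiability of h_{G°} at x. -/
lemma smoothBoundary_eq (hG : IsConvexBody G) (h0 : 0 ∈ interior G) :
    smoothBoundary G =
      {x | supp (polarBody G) x = 1 ∧ DifferentiableAt ℝ (supp (polarBody G)) x} := by
  have hc := isCompact_polarBody hG.isCompact h0
  have hne : (polarBody G).Nonempty := ⟨0, zero_mem_polarBody G⟩
  ext x
  simp only [smoothBoundary, mem_ofPred_eq, mem_frontier_iff_supp_polarBody hG h0]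
  refine and_congr_right fun hx => ⟨?_, fun hd => ?_⟩
  · rintro ⟨u, -, huniq⟩
    obtain ⟨p, hp, hpx⟩ := exists_inner_eq_supp hc hne x
    refine differentiableAt_supp_of_unique hc hne hp fun q hq hqx => ?_
    rw [hx] at hpx hqx
    have e1 := huniq _ ((isOuterUnitNormal_iff hG h0 hx).2 ⟨p, hp, hpx, rfl⟩)
    have e2 := huniq _ ((isOuterUnitNormal_iff hG h0 hx).2 ⟨q, hq, hqx, rfl⟩)
    have hp0 : ‖p‖ ≠ 0 := norm_ne_zero_iff.2 fun h => by simp [h] at hpx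
    have hq0 : ‖q‖ ≠ 0 := norm_ne_zero_iff.2 fun h => by simp [h] at hqx
    have e3 : ‖q‖⁻¹ • q = ‖p‖⁻¹ • p := e2.trans e1.symm
    -- Pairing with x, where both p and q take the value 1, recovers the norms from the common
    -- direction.
    have e4 : ‖q‖⁻¹ = ‖p‖⁻¹ := by
      have := congrArg (fun v => ⟪v, x⟫) e3
      simpa [real_inner_smul_left, hpx, hqx] using this
    rw [e4] at e3
    exact smul_right_injective _ (inv_ne_zero hp0) e3
  · refine ⟨_, (isOuterUnitNormal_iff hG h0 hx).2 ⟨_, gradient_supp_mem hc hne hd,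
      (inner_gradient_supp hc hne hd).trans hx, rfl⟩, fun u hu => ?_⟩
    obtain ⟨p, hp, hpx, rfl⟩ := (isOuterUnitNormal_iff hG h0 hx).1 hu
    rw [eq_gradient_of_inner_eq_supp hc hd hp (hpx.trans hx.symm)]

lemma outerNormal_eq (hG : IsConvexBody G) (h0 : 0 ∈ interior G) {x : E d}
    (hx : x ∈ smoothBoundary G) :
    outerNormal G x = ‖gradient (supp (polarBody G)) x‖⁻¹ • gradient (supp (polarBody G)) x := by
  have hc := isCompact_polarBody hG.isCompact h0
  have hne : (polarBody G).Nonempty := ⟨0, zero_mem_polarBody G⟩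
  have hx' := hx
  rw [smoothBoundary_eq hG h0] at hx'
  rw [outerNormal, dif_pos hx]
  exact hx.2.unique hx.2.choose_spec.1 ((isOuterUnitNormal_iff hG h0 hx'.1).2
    ⟨_, gradient_supp_mem hc hne hx'.2, (inner_gradient_supp hc hne hx'.2).trans hx'.1, rfl⟩)

lemma measurableSet_smoothBoundary (hG : IsConvexBody G) (h0 : 0 ∈ interior G) :
    MeasurableSet (smoothBoundary G) := by
  rw [smoothBoundary_eq hG h0]
  exact (measurableSet_eq_fun (continuous_supp (isCompact_polarBody hG.isCompact h0)
    ⟨0, zero_mem_polarBody G⟩).measurable measurable_const).inter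
    (measurableSet_of_differentiableAt ℝ _)

end Boundary

/-! ### Polar coordinates and homogeneous functions. -/

/-- Spherical Lebesgue measure on the unit sphere of `ℝ^d`. -/
noncomputable abbrev sphereMeasure (d : ℕ) : Measure (sphere (0 : E d) 1) :=
  (volume : Measure (E d)).toSphere

section Polar

/-- Integration in polar coordinates. -/
lemma lintegral_polar (hd : 0 < d) {f : E d → ℝ≥0∞} (hf : Measurable f) :
    ∫⁻ x, f x = ∫⁻ θ, (∫⁻ r in Ioi (0 : ℝ), ENNReal.ofReal (r ^ (d - 1)) * f (r • θ.1))
      ∂(sphereMeasure d) := by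
  have : Nonempty (Fin d) := ⟨⟨0, hd⟩⟩
  have hfin : Module.finrank ℝ (E d) = d := by simp
  have hmp := (volume : Measure (E d)).measurePreserving_homeomorphUnitSphereProd
  rw [hfin] at hmp
  have hms : MeasurableSet ({0}ᶜ : Set (E d)) := (measurableSet_singleton _).compl
  have hsymm := hmp.symm (homeomorphUnitSphereProd (E d)).toMeasurableEquiv
  calc ∫⁻ x, f x = ∫⁻ x in ({0}ᶜ : Set (E d)), f x := by
        rw [restrict_compl_singleton]
    _ = ∫⁻ x : ({0}ᶜ : Set (E d)), f x.1 ∂((volume : Measure (E d)).comap Subtype.val) :=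
        (lintegral_subtype_comap hms f).symm
    _ = ∫⁻ p, f (p.2.1 • p.1.1)
          ∂((sphereMeasure d).prod (Measure.volumeIoiPow (d - 1))) := by
        rw [← hsymm.lintegral_comp (f := fun x : ({0}ᶜ : Set (E d)) => f x.1)
          (hf.comp measurable_subtype_coe)]
        rfl
    _ = ∫⁻ θ, ∫⁻ r, f (r.1 • θ.1) ∂(Measure.volumeIoiPow (d - 1)) ∂(sphereMeasure d) := by
        rw [lintegral_prod]
        exact (hf.comp (by fun_prop)).aemeasurable
    _ = _ := by
        refine lintegral_congr fun θ => ?_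
        have hg : Measurable fun r : Ioi (0 : ℝ) => f (r.1 • θ.1) := hf.comp (by fun_prop)
        rw [Measure.volumeIoiPow, lintegral_withDensity_eq_lintegral_mul _ (by fun_prop) hg]
        exact lintegral_subtype_comap measurableSet_Ioi
          (fun r : ℝ => ENNReal.ofReal (r ^ (d - 1)) * f (r • θ.1))

/-- A property that is invariant under positive dilations and holds almost everywhere holds in
almost every direction. -/
lemma ae_sphere_of_ae {P : E d → Prop} (hP : MeasurableSet {x | P x})
    (hinv : ∀ x, ∀ t : ℝ, 0 < t → P (t • x) → P x) (h : ∀ᵐ x, P x) :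
    ∀ᵐ θ ∂(sphereMeasure d), P θ.1 := by
  rw [ae_iff]
  have hm : MeasurableSet {θ : sphere (0 : E d) 1 | ¬ P θ.1} :=
    (measurable_subtype_coe hP).compl
  -- Spherical measure of a set is d times the volume of the cone over it; here that cone lies in
  -- the null set where `P` fails.
  rw [Measure.toSphere_apply' _ hm]
  have : volume (Ioo (0 : ℝ) 1 • ((fun θ : sphere (0 : E d) 1 => θ.1) '' {θ | ¬ P θ.1})) = 0 := by
    refine measure_mono_null ?_ (ae_iff.1 h)
    rintro _ ⟨t, ht, _, ⟨θ, hθ, rfl⟩, rfl⟩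
    exact fun hcon => hθ (hinv _ _ ht.1 hcon)
  rw [this, mul_zero]

lemma lintegral_Ioc_pow (hd : 0 < d) {b : ℝ} (hb : 0 ≤ b) :
    ∫⁻ r in Ioc 0 b, ENNReal.ofReal (r ^ (d - 1)) = ENNReal.ofReal (b ^ d / d) := by
  rw [← ofReal_integral_eq_lintegral_ofReal, ← intervalIntegral.integral_of_le hb, integral_pow]
  · rw [Nat.sub_add_cancel hd, zero_pow hd.ne', sub_zero, Nat.cast_sub hd]
    simp
  · exact (intervalIntegral.intervalIntegrable_pow _).1
  · filter_upwards [ae_restrict_mem measurableSet_Ioc] with y hy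
    exact pow_nonneg hy.1.le _

/-- Polar integration of a function over the part `{r ≤ b}` of a ray. -/
lemma setLIntegral_polar (hd : 0 < d) {h : E d → ℝ} (hh : Measurable h)
    (hhom : ∀ x, ∀ t : ℝ, 0 < t → h (t • x) = t * h x)
    (hpos : ∀ θ : sphere (0 : E d) 1, 0 < h θ.1) {f : E d → ℝ≥0∞} (hf : Measurable f) :
    ∫⁻ x in {x | h x ≤ 1}, f x = ∫⁻ θ, (∫⁻ r in Ioc (0 : ℝ) (h θ.1)⁻¹,
      ENNReal.ofReal (r ^ (d - 1)) * f (r • θ.1)) ∂(sphereMeasure d) := by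
  have hm : MeasurableSet {x | h x ≤ 1} := measurableSet_le hh measurable_const
  rw [← lintegral_indicator hm, lintegral_polar hd (hf.indicator hm)]
  refine lintegral_congr fun θ => ?_
  have hset : Ioc (0 : ℝ) (h θ.1)⁻¹ = Iic (h θ.1)⁻¹ ∩ Ioi 0 := by
    ext r; simp [and_comm]
  rw [hset, ← Measure.restrict_restrict measurableSet_Iic, ← lintegral_indicator measurableSet_Iic]
  refine setLIntegral_congr_fun measurableSet_Ioi fun r hr => ?_
  have hiff : (r • θ.1 ∈ {x | h x ≤ 1}) ↔ r ∈ Iic (h θ.1)⁻¹ := by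
    rw [mem_ofPred_eq, hhom _ _ hr, mem_Iic, ← le_div_iff₀ (hpos θ), one_div]
  by_cases hr' : r ∈ Iic (h θ.1)⁻¹
  · simp only [indicator_of_mem hr', indicator_of_mem (hiff.2 hr')]
  · simp only [indicator_of_notMem hr', indicator_of_notMem (fun hc => hr' (hiff.1 hc)), mul_zero]

/-- The integral of a `0`-homogeneous function over the unit ball of a `1`-homogeneous one. -/
lemma setLIntegral_homogeneous (hd : 0 < d) {h : E d → ℝ} (hh : Measurable h)
    (hhom : ∀ x, ∀ t : ℝ, 0 < t → h (t • x) = t * h x)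
    (hpos : ∀ θ : sphere (0 : E d) 1, 0 < h θ.1) {Q : E d → ℝ≥0∞} (hQ : Measurable Q)
    (hQhom : ∀ x, ∀ t : ℝ, 0 < t → Q (t • x) = Q x) :
    d * ∫⁻ x in {x | h x ≤ 1}, Q x =
      ∫⁻ θ, Q θ.1 * ENNReal.ofReal ((h θ.1 ^ d)⁻¹) ∂(sphereMeasure d) := by
  rw [setLIntegral_polar hd hh hhom hpos hQ, ← lintegral_const_mul' _ _ (by simp)]
  refine lintegral_congr fun θ => ?_
  have h1 : ∫⁻ r in Ioc (0 : ℝ) (h θ.1)⁻¹, ENNReal.ofReal (r ^ (d - 1)) * Q (r • θ.1) =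
      ∫⁻ r in Ioc (0 : ℝ) (h θ.1)⁻¹, ENNReal.ofReal (r ^ (d - 1)) * Q θ.1 :=
    setLIntegral_congr_fun measurableSet_Ioc fun r hr => by simp only [hQhom _ _ hr.1]
  have hd' : (0 : ℝ) < d := by exact_mod_cast hd
  rw [h1, lintegral_mul_const _ (by fun_prop), lintegral_Ioc_pow hd (inv_pos.2 (hpos θ)).le,
    ← mul_assoc, ← ENNReal.ofReal_natCast, ← ENNReal.ofReal_mul hd'.le, mul_div_cancel₀ _ hd'.ne',
    inv_pow, mul_comm]

lemma volume_homogeneous (hd : 0 < d) {h : E d → ℝ} (hh : Measurable h)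
    (hhom : ∀ x, ∀ t : ℝ, 0 < t → h (t • x) = t * h x)
    (hpos : ∀ θ : sphere (0 : E d) 1, 0 < h θ.1) :
    d * volume {x | h x ≤ 1} =
      ∫⁻ θ, ENNReal.ofReal ((h θ.1 ^ d)⁻¹) ∂(sphereMeasure d) := by
  simpa using setLIntegral_homogeneous hd hh hhom hpos (Q := fun _ => 1) measurable_const
    (fun _ _ _ => rfl)

end Polar

section SupportPolar

variable {A : Set (E d)}

lemma sphere_ne_zero (θ : sphere (0 : E d) 1) : θ.1 ≠ 0 := ne_zero_of_mem_unit_sphere θ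

lemma ae_differentiableAt_supp (hA : IsCompact A) (hne : A.Nonempty) :
    ∀ᵐ x, DifferentiableAt ℝ (supp A) x :=
  (exists_lipschitzWith_supp hA hne).choose_spec.ae_differentiableAt

/-- Rademacher's theorem passes to directions because differentiability is constant along open rays.
-/
lemma ae_sphere_differentiableAt_supp (hA : IsCompact A) (hne : A.Nonempty) :
    ∀ᵐ θ ∂(sphereMeasure d), DifferentiableAt ℝ (supp A) θ.1 :=
  ae_sphere_of_ae (measurableSet_of_differentiableAt ℝ _)
    (fun _ _ ht h => (differentiableAt_supp_smul_iff hA hne ht).1 h)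
    (ae_differentiableAt_supp hA hne)

end SupportPolar

/-! ### Funk balls as translates, and their support functions. -/

section Translate

variable {K : Set (E d)} {x : E d}

lemma zero_mem_interior_translate (hx : x ∈ interior K) :
    (0 : E d) ∈ interior ((fun z => z - x) '' K) := by
  have : (fun z => z - x) '' interior K ⊆ interior ((fun z => z - x) '' K) :=
    ((Homeomorph.subRight x).image_interior K).subset
  exact this ⟨x, hx, sub_self x⟩

lemma isCompact_translate (hK : IsCompact K) (x : E d) :
    IsCompact ((fun z => z - x) '' K) := hK.image (by fun_prop)

lemma convex_translate (hK : Convex ℝ K) (x : E d) :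
    Convex ℝ ((fun z => z - x) '' K) := by
  simpa [sub_eq_add_neg, add_comm] using hK.translate (-x)

lemma funkBall_eq (hK : IsConvexBody K) (hx : x ∈ interior K) :
    funkBall K x = (fun z => z - x) '' K := by
  ext v
  have h0 := mem_interior_iff_mem_nhds.1 (zero_mem_interior_translate hx)
  rw [funkBall, mem_ofPred_eq, funkFinsler,
    gauge_le_one_iff_mem_closure (convex_translate hK.convex x) h0,
    (isCompact_translate hK.isCompact x).isClosed.closure_eq]

lemma supp_translate (hK : IsCompact K) (hne : K.Nonempty) (x w : E d) :
    supp ((fun z => z - x) '' K) w = supp K w - ⟪x, w⟫ := by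
  apply le_antisymm
  · rw [supp_le_iff (isCompact_translate hK x) (hne.image _)]
    rintro _ ⟨a, ha, rfl⟩
    rw [inner_sub_left]
    linarith [inner_le_supp hK ha w]
  · obtain ⟨a, ha, e⟩ := exists_inner_eq_supp hK hne w
    rw [← e, ← inner_sub_left]
    exact inner_le_supp (isCompact_translate hK x) ⟨a, ha, rfl⟩ w

lemma gradient_supp_translate (hK : IsCompact K) (hne : K.Nonempty) (x : E d) {w : E d}
    (hd : DifferentiableAt ℝ (supp K) w) :
    gradient (supp ((fun z => z - x) '' K)) w = gradient (supp K) w - x := by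
  have hd' : DifferentiableAt ℝ (supp ((fun z => z - x) '' K)) w := by
    simp only [funext (supp_translate hK hne x)]
    exact hd.sub (innerSL ℝ x).differentiableAt
  refine (eq_gradient_of_inner_eq_supp (isCompact_translate hK x) hd'
    ⟨_, gradient_supp_mem hK hne hd, rfl⟩ ?_).symm
  rw [inner_sub_left, inner_gradient_supp hK hne hd, supp_translate hK hne]

end Translate

/-! ### Duality of the volume. -/

section Volume

variable {G K : Set (E d)}

/-- The dual pair thus satisfies the same hypotheses. Strictness comes from compactness: ⟪·, y⟫
attains its maximum over `G` at a point interior to `K`, where h_{K°} < 1. -/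
lemma polarBody_subset_interior_polarBody (hG : IsConvexBody G) (hK : IsConvexBody K)
    (h0 : 0 ∈ interior G) (hGK : G ⊆ interior K) :
    polarBody K ⊆ interior (polarBody G) := by
  have hne : G.Nonempty := ⟨0, interior_subset h0⟩
  have h0K : 0 ∈ interior K := hGK (interior_subset h0)
  intro y hy
  rw [polarBody_eq_supp_le hG.isCompact hne]
  refine interior_mono (s := {w | supp G w < 1})
    (fun w hw => (show supp G w < 1 from hw).le) ?_
  rw [(isOpen_lt (continuous_supp hG.isCompact hne) continuous_const).interior_eq]
  obtain ⟨a, ha, e⟩ := exists_inner_eq_supp hG.isCompact hne y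
  have h1 := supp_polarBody_lt_one_of_mem_interior hK h0K (hGK ha)
  have h2 := inner_le_supp (isCompact_polarBody hK.isCompact h0K) hy a
  rw [mem_ofPred_eq, ← e, real_inner_comm]
  linarith

lemma volume_polarBody_funkBall (hd : 0 < d) (hK : IsConvexBody K) {x : E d}
    (hx : x ∈ interior K) :
    d * volume (polarBody (funkBall K x)) =
      ∫⁻ θ, ENNReal.ofReal (((supp K θ.1 - ⟪x, θ.1⟫) ^ d)⁻¹) ∂(sphereMeasure d) := by
  have hc := isCompact_translate hK.isCompact x
  have h0 := zero_mem_interior_translate hx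
  have hne : ((fun z => z - x) '' K).Nonempty := ⟨0, interior_subset h0⟩
  rw [funkBall_eq hK hx, polarBody_eq_supp_le hc hne,
    volume_homogeneous hd (continuous_supp hc hne).measurable
      (fun w t ht => supp_smul hc hne ht.le w) (fun θ => supp_pos hc h0 (sphere_ne_zero θ))]
  simp only [supp_translate hK.isCompact ⟨x, interior_subset hx⟩ x]

/-- The radial integral `∫_0^{1/p} ρ^{d-1} (1 - ρ c)^{-d} dρ`. -/
noncomputable def radialKernel (d : ℕ) (c p : ℝ) : ℝ≥0∞ :=
  ∫⁻ ρ in Ioc 0 p⁻¹, ENNReal.ofReal (ρ ^ (d - 1)) * ENNReal.ofReal (((1 - ρ * c) ^ d)⁻¹)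

lemma measurable_radialKernel (d : ℕ) :
    Measurable fun q : ℝ × ℝ => radialKernel d q.1 q.2 := by
  have h : ∀ q : ℝ × ℝ, radialKernel d q.1 q.2 = ∫⁻ ρ : ℝ,
      {z : (ℝ × ℝ) × ℝ | 0 < z.2 ∧ z.2 ≤ z.1.2⁻¹}.indicator (fun z => ENNReal.ofReal (z.2 ^ (d - 1)) *
        ENNReal.ofReal (((1 - z.2 * z.1.1) ^ d)⁻¹)) (q, ρ) := by
    intro q
    rw [radialKernel, ← lintegral_indicator measurableSet_Ioc]
    rfl
  simp only [h]
  refine Measurable.lintegral_prod_right' (Measurable.indicator (by fun_prop) ?_)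
  have h2 : Measurable fun z : (ℝ × ℝ) × ℝ => z.1.2⁻¹ := by fun_prop
  exact (measurableSet_lt measurable_const measurable_snd).inter
    (measurableSet_le measurable_snd h2)

/-- Substitute r = hρ: the Jacobian h, the factor h^{d-1} and the factor h^{-d} cancel. Only the
product g h survives, and the symmetry of the volume rests on this. -/
lemma lintegral_eq_radialKernel (hd : 0 < d) (c : ℝ) {g h : ℝ} (hh : 0 < h) :
    ∫⁻ r in Ioc 0 g⁻¹, ENNReal.ofReal (r ^ (d - 1)) * ENNReal.ofReal (((h - r * c) ^ d)⁻¹) =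
      radialKernel d c (g * h) := by
  have himg : Ioc 0 g⁻¹ = (fun ρ => h * ρ) '' Ioc 0 (g * h)⁻¹ := by
    rw [image_mul_left_Ioc hh, mul_zero, mul_inv, mul_left_comm, mul_inv_cancel₀ hh.ne', mul_one]
  rw [himg, lintegral_image_eq_lintegral_abs_deriv_mul (f' := fun _ => h) measurableSet_Ioc
    (fun x _ => by simpa using ((hasDerivAt_id x).const_mul h).hasDerivWithinAt)
    (mul_right_injective₀ hh.ne').injOn, radialKernel]
  refine lintegral_congr fun ρ => ?_
  have e : h - h * ρ * c = h * (1 - ρ * c) := by ring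
  have hp : (0 : ℝ) < h ^ d := by positivity
  rw [abs_of_pos hh, e, mul_pow, mul_pow, mul_inv, ENNReal.ofReal_mul (by positivity),
    ENNReal.ofReal_mul (inv_pos.2 hp).le]
  have e2 : ENNReal.ofReal h * ENNReal.ofReal (h ^ (d - 1)) * ENNReal.ofReal (h ^ d)⁻¹ = 1 := by
    rw [← ENNReal.ofReal_mul hh.le, ← pow_succ', Nat.sub_add_cancel hd,
      ← ENNReal.ofReal_mul hp.le, mul_inv_cancel₀ hp.ne', ENNReal.ofReal_one]
  calc _ = (ENNReal.ofReal h * ENNReal.ofReal (h ^ (d - 1)) * ENNReal.ofReal (h ^ d)⁻¹) *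
        (ENNReal.ofReal (ρ ^ (d - 1)) * ENNReal.ofReal ((1 - ρ * c) ^ d)⁻¹) := by ring
    _ = _ := by rw [e2, one_mul]

/-- The Funk Holmes–Thompson volume as a double integral over directions. -/
lemma funkVolume_eq (hd : 0 < d) (hG : IsConvexBody G) (hK : IsConvexBody K)
    (h0 : 0 ∈ interior G) (hGK : G ⊆ interior K) :
    funkVolume K G = (∫⁻ φ, (∫⁻ θ, radialKernel d ⟪φ.1, θ.1⟫ (supp (polarBody G) φ.1 * supp K θ.1)
      ∂(sphereMeasure d)) ∂(sphereMeasure d)) / (d * unitBallVolume d) := by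
  have hne : K.Nonempty := ⟨0, interior_subset (hGK (interior_subset h0))⟩
  have hcP := isCompact_polarBody hG.isCompact h0
  have hneP : (polarBody G).Nonempty := ⟨0, zero_mem_polarBody G⟩
  have h0P := zero_mem_interior_polarBody hG.isCompact ⟨0, interior_subset h0⟩
  have hcs := continuous_supp hcP hneP
  have hd0 : (d : ℝ≥0∞) ≠ 0 := by exact_mod_cast hd.ne'
  have hset : G = {x | supp (polarBody G) x ≤ 1} := by
    ext x; exact mem_iff_supp_polarBody_le hG h0
  have hk : Measurable fun p : E d × sphere (0 : E d) 1 =>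
      ENNReal.ofReal (((supp K p.2.1 - ⟪p.1, p.2.1⟫) ^ d)⁻¹) := by
    have := (continuous_supp hK.isCompact hne).measurable
    have h1 : Measurable fun p : E d × sphere (0 : E d) 1 => ⟪p.1, p.2.1⟫ :=
      Continuous.measurable (by fun_prop)
    fun_prop
  have key : ∫⁻ x in G, d * volume (polarBody (funkBall K x)) =
      ∫⁻ φ, (∫⁻ θ, radialKernel d ⟪φ.1, θ.1⟫ (supp (polarBody G) φ.1 * supp K θ.1)
        ∂(sphereMeasure d)) ∂(sphereMeasure d) := by
    rw [setLIntegral_congr_fun hG.isCompact.measurableSet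
      (fun x hx => volume_polarBody_funkBall hd hK (hGK hx))]
    conv_lhs => rw [hset]
    rw [setLIntegral_polar hd hcs.measurable (fun w t ht => supp_smul hcP hneP ht.le w)
      (fun θ => supp_pos hcP h0P (sphere_ne_zero θ)) hk.lintegral_prod_right']
    refine lintegral_congr fun φ => ?_
    have hm1 : Measurable fun p : ℝ × sphere (0 : E d) 1 => ENNReal.ofReal (p.1 ^ (d - 1)) *
        ENNReal.ofReal (((supp K p.2.1 - ⟪p.1 • φ.1, p.2.1⟫) ^ d)⁻¹) := by
      refine Measurable.mul (by fun_prop) (hk.comp (g := fun p : E d × sphere (0 : E d) 1 =>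
        ENNReal.ofReal (((supp K p.2.1 - ⟪p.1, p.2.1⟫) ^ d)⁻¹))
        (f := fun p : ℝ × sphere (0 : E d) 1 => (p.1 • φ.1, p.2)) (by fun_prop))
    calc _ = ∫⁻ r in Ioc 0 (supp (polarBody G) φ.1)⁻¹, (∫⁻ θ, ENNReal.ofReal (r ^ (d - 1)) *
          ENNReal.ofReal (((supp K θ.1 - ⟪r • φ.1, θ.1⟫) ^ d)⁻¹) ∂(sphereMeasure d)) := by
          refine lintegral_congr fun r => ?_
          rw [lintegral_const_mul' _ _ ENNReal.ofReal_ne_top]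
      _ = _ := by
          -- The radial integral must be innermost, since the substitution depends on θ through
          -- h_K(θ).
          rw [lintegral_lintegral_swap hm1.aemeasurable]
          refine lintegral_congr fun θ => ?_
          simp only [real_inner_smul_left]
          exact lintegral_eq_radialKernel hd _
            (supp_pos hK.isCompact (hGK (interior_subset h0)) (sphere_ne_zero θ))
  rw [← key, funkVolume, lintegral_const_mul' _ _ (by simp)]
  simp only [volumeDensity, ENNReal.div_eq_inv_mul]
  rw [lintegral_const_mul']
  · rw [ENNReal.mul_inv (Or.inl hd0) (Or.inl (by simp)), mul_comm (d : ℝ≥0∞)⁻¹, mul_assoc,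
      ← mul_assoc _ (d : ℝ≥0∞), ENNReal.inv_mul_cancel hd0 (by simp), one_mul]
  · rw [ENNReal.inv_ne_top, unitBallVolume]
    exact (Metric.measure_closedBall_pos _ _ one_pos).ne'

/-- Duality of the Funk Holmes–Thompson volume. -/
theorem funkVolume_duality (hd : 0 < d) (hG : IsConvexBody G) (hK : IsConvexBody K)
    (h0 : 0 ∈ interior G) (hGK : G ⊆ interior K) :
    funkVolume K G = funkVolume (polarBody G) (polarBody K) := by
  have h0K : 0 ∈ interior K := hGK (interior_subset h0)
  have hcP := isCompact_polarBody hG.isCompact h0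
  have hneP : (polarBody G).Nonempty := ⟨0, zero_mem_polarBody G⟩
  rw [funkVolume_eq hd hG hK h0 hGK, funkVolume_eq hd (hK.polarBody h0K) (hG.polarBody h0)
    (zero_mem_interior_polarBody hK.isCompact ⟨0, interior_subset h0K⟩)
    (polarBody_subset_interior_polarBody hG hK h0 hGK),
    polarBody_polarBody hK.isCompact.isClosed hK.convex (interior_subset h0K)]
  congr 1
  -- Exchanging φ and θ matches the two sides: the kernel sees only ⟪φ, θ⟫ and a product of support
  -- functions.
  rw [lintegral_lintegral_swap]
  · simp only [real_inner_comm, mul_comm]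
  · have h1 := (continuous_supp hcP hneP).measurable
    have h2 := (continuous_supp hK.isCompact ⟨0, interior_subset h0K⟩).measurable
    have h3 : Measurable fun p : sphere (0 : E d) 1 × sphere (0 : E d) 1 => ⟪p.1.1, p.2.1⟫ :=
      Continuous.measurable (by fun_prop)
    exact ((measurable_radialKernel d).comp (f := fun p : sphere (0 : E d) 1 × sphere (0 : E d) 1 =>
      (⟪p.1.1, p.2.1⟫, supp (polarBody G) p.1.1 * supp K p.2.1)) (by fun_prop)).aemeasurable

end Volume

/-! ### Variation of a convex function on the line. -/

section Line

variable {f : ℝ → ℝ} {C : NNReal} {t₀ : ℝ}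

/-- Right of its minimizer `f` is nondecreasing and the sublevel set is an interval ending at a
point β with f β = 1, so the integral of |f'| telescopes to f β - f t₀. -/
lemma lintegral_abs_deriv_right (hc : ConvexOn ℝ univ f) (hl : LipschitzWith C f)
    (hmin : ∀ t, f t₀ ≤ f t) (hb : ∃ b ≥ t₀, 1 ≤ f b) (hlt : f t₀ < 1) :
    ∫⁻ t in {t | f t ≤ 1} ∩ Ioi t₀, ENNReal.ofReal |deriv f t| = ENNReal.ofReal (1 - f t₀) := by
  obtain ⟨b, hb0, hb1⟩ := hb
  obtain ⟨β, hβ, hβ1⟩ := intermediate_value_Icc hb0 hl.continuous.continuousOn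
    (show (1 : ℝ) ∈ Icc (f t₀) (f b) from ⟨hlt.le, hb1⟩)
  have hβ0 : t₀ < β := lt_of_le_of_ne hβ.1 (fun h => by rw [← h] at hβ1; exact hlt.ne hβ1)
  have hmono : MonotoneOn f (Ici t₀) := by
    intro s hs t ht hst
    have := hc.le_max_of_mem_Icc (mem_univ t₀) (mem_univ t) (z := s) ⟨hs, hst⟩
    rwa [max_eq_right (hmin t)] at this
  have hset : {t | f t ≤ 1} ∩ Ioi t₀ = Ioc t₀ β := by
    ext t
    constructor
    · rintro ⟨h1, h2⟩
      refine ⟨h2, ?_⟩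
      by_contra! hcon
      have h3 := hc.lt_right_of_left_lt (mem_univ t₀) (mem_univ t)
        (Ioo_subset_openSegment ⟨hβ0, hcon⟩) (hβ1 ▸ hlt)
      rw [hβ1] at h3
      exact absurd h1 (not_le.2 h3)
    · rintro ⟨h1, h2⟩
      exact ⟨(hmono h1.le hβ.1 h2).trans_eq hβ1, h1⟩
  have hd : ∀ t ∈ Ioc t₀ β, 0 ≤ deriv f t := fun t ht => by
    rw [← derivWithin_of_mem_nhds (Ici_mem_nhds ht.1)]
    exact hmono.derivWithin_nonneg
  have hac : AbsolutelyContinuousOnInterval f t₀ β :=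
    (hl.lipschitzOnWith (s := uIcc t₀ β)).absolutelyContinuousOnInterval
  rw [hset, setLIntegral_congr_fun (g := fun t => ENNReal.ofReal (deriv f t)) measurableSet_Ioc
    (fun t ht => by simp only [abs_of_nonneg (hd t ht)]),
    ← ofReal_integral_eq_lintegral_ofReal, ← intervalIntegral.integral_of_le hβ.1,
    hac.integral_deriv_eq_sub, hβ1]
  · exact hac.intervalIntegrable_deriv.1
  · filter_upwards [ae_restrict_mem measurableSet_Ioc] with t ht using hd t ht

/-- The total variation of a convex function of one variable over its sublevel set at height `1`. -/
lemma lintegral_abs_deriv_sublevel (hc : ConvexOn ℝ univ f) (hl : LipschitzWith C f)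
    (hmin : ∀ t, f t₀ ≤ f t) (hb : ∃ b ≥ t₀, 1 ≤ f b) (ha : ∃ a ≤ t₀, 1 ≤ f a) :
    ∫⁻ t in {t | f t ≤ 1}, ENNReal.ofReal |deriv f t| = ENNReal.ofReal (2 * (1 - f t₀)) := by
  have hms : MeasurableSet {t | f t ≤ 1} :=
    measurableSet_le hl.continuous.measurable measurable_const
  rcases le_or_gt 1 (f t₀) with hge | hlt
  -- Here every point of the sublevel set is a global minimizer, so f' = 0 there, while
  -- `ENNReal.ofReal` truncates the right side to 0.
  · rw [setLIntegral_congr_fun (g := fun _ => 0) hms, ENNReal.ofReal_of_nonpos (by linarith)]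
    · simp
    · intro t ht
      have : IsLocalMin f t :=
        Eventually.of_forall fun s => (show f t ≤ 1 from ht).trans (hge.trans (hmin s))
      simp only [this.deriv_eq_zero, abs_zero, ENNReal.ofReal_zero]
  · have h1 := lintegral_abs_deriv_right hc hl hmin hb hlt
    -- The part left of t₀ is the right part of the reflected function; the point t₀ itself is
    -- negligible.
    have h2 := lintegral_abs_deriv_right (f := fun t => f (-t)) (t₀ := -t₀) (C := C)
      (hc.comp_linearMap (-LinearMap.id : ℝ →ₗ[ℝ] ℝ))
      (LipschitzWith.of_dist_le_mul fun x y => by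
        simpa using hl.dist_le_mul (-x) (-y))
      (fun t => by simpa using hmin (-t))
      (by obtain ⟨a, ha, h⟩ := ha; exact ⟨-a, by simpa using ha, by simpa using h⟩) (by simpa)
    rw [← lintegral_inter_add_sdiff _ _ (measurableSet_Ioi (a := t₀)), h1]
    have h3 : ∫⁻ t in {t | f t ≤ 1} \ Ioi t₀, ENNReal.ofReal |deriv f t| =
        ∫⁻ t in {t | f (-t) ≤ 1} ∩ Ioi (-t₀), ENNReal.ofReal |deriv (fun t => f (-t)) t| := by
      have e : {t | f t ≤ 1} \ Ioi t₀ = {t | f t ≤ 1} ∩ Iic t₀ := by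
        ext t; simp
      have hms' : MeasurableSet ({t | f (-t) ≤ 1} ∩ Ioi (-t₀)) :=
        (hms.preimage measurable_neg).inter measurableSet_Ioi
      rw [e, setLIntegral_congr (ae_eq_set_inter (ae_eq_refl {t | f t ≤ 1}) Iio_ae_eq_Iic.symm),
        ← lintegral_indicator (hms.inter measurableSet_Iio), ← lintegral_indicator hms',
        ← lintegral_neg_eq_self]
      refine lintegral_congr fun t => ?_
      simp only [indicator, deriv_comp_neg, abs_neg]
      refine if_congr ?_ rfl rfl
      simp [neg_lt]
    rw [h3, h2, neg_neg, ← ENNReal.ofReal_add (by linarith) (by linarith)]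
    ring_nf

end Line

/-! ### Polars of hyperplane sections and the Cauchy-type formula. -/

section Hyperplane

variable {A : Set (E d)} {n : E d}

lemma mem_orthogonal_iff {y : E d} :
    y ∈ (Submodule.span ℝ {n})ᗮ ↔ ⟪n, y⟫ = 0 :=
  Submodule.mem_orthogonal_singleton_iff_inner_right

/-- The polar of a hyperplane section is the projection of the polar. -/
lemma exists_add_smul_mem_polarBody (hA : IsCompact A) (hconv : Convex ℝ A)
    (h0 : 0 ∈ interior A) (hn : ‖n‖ = 1) {y : E d}
    (hy : y ∈ polarIn (Submodule.span ℝ {n})ᗮ (A ∩ (Submodule.span ℝ {n})ᗮ)) :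
    ∃ t : ℝ, y + t • n ∈ polarBody A := by
  have hnn : ⟪n, n⟫ = 1 := by rw [real_inner_self_eq_norm_sq, hn, one_pow]
  -- `L` is the orthogonal projection along the unit vector n.
  let L : E d →ₗ[ℝ] E d := LinearMap.id - (innerₗ (E d) n).smulRight n
  have hL : ∀ w, L w = w - ⟪n, w⟫ • n := fun w => by simp [L]
  have hLc : Continuous L := L.continuous_of_finiteDimensional
  have hyn : ⟪n, y⟫ = 0 := mem_orthogonal_iff.1 hy.1
  suffices y ∈ L '' polarBody A by
    obtain ⟨w, hw, rfl⟩ := this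
    refine ⟨⟪n, w⟫, ?_⟩
    rwa [hL, sub_add_cancel]
  by_contra hcon
  -- If y were outside the projected polar, a separating z would exist. By self-adjointness `L z` is
  -- at most 1 on A°, so it lies in A°° = A and in the hyperplane, contradicting the choice of y.
  obtain ⟨z, hz, hyz⟩ := exists_polarBody_one_lt_inner
    ((isCompact_polarBody hA h0).image hLc).isClosed ((convex_polarBody A).linear_image L)
    ⟨0, zero_mem_polarBody A, map_zero L⟩ hcon
  have hzA : L z ∈ A := by
    rw [← polarBody_polarBody hA.isClosed hconv (interior_subset h0)]
    intro w hw
    have := hz _ ⟨w, hw, rfl⟩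
    rw [hL, inner_sub_left, real_inner_smul_left] at this
    rw [hL, inner_sub_right, real_inner_smul_right, real_inner_comm n w]
    linarith
  have hzT : L z ∈ (Submodule.span ℝ {n})ᗮ := by
    rw [mem_orthogonal_iff, hL, inner_sub_right, real_inner_smul_right, hnn]
    ring
  have := hy.2 _ ⟨hzA, hzT⟩
  rw [hL, inner_sub_left, real_inner_smul_left, hyn, real_inner_comm] at this
  linarith

lemma isCompact_section (hA : IsCompact A) (T : Submodule ℝ (E d)) : IsCompact (A ∩ (T : Set (E d))) :=
  hA.inter_right T.closed_of_finiteDimensional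

lemma section_nonempty (h0 : 0 ∈ A) (T : Submodule ℝ (E d)) : (A ∩ (T : Set (E d))).Nonempty :=
  ⟨0, h0, T.zero_mem⟩

lemma polarIn_section_eq (hA : IsCompact A) (h0 : 0 ∈ A) (T : Submodule ℝ (E d)) :
    polarIn T (A ∩ T) = Subtype.val '' {y : T | supp (A ∩ T) y ≤ 1} := by
  ext y
  simp only [polarIn, mem_ofPred_eq, mem_image, Subtype.exists, exists_and_right, exists_eq_right,
    supp_le_iff (isCompact_section hA T) (section_nonempty h0 T), exists_prop]

lemma supp_section_le (hA : IsCompact A) (h0 : 0 ∈ A) {y : E d} (t : ℝ) :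
    supp (A ∩ (Submodule.span ℝ {n})ᗮ) y ≤ supp A (y + t • n) := by
  rw [supp_le_iff (isCompact_section hA _) (section_nonempty h0 _)]
  rintro a ⟨ha, haT⟩
  have h1 : ⟪n, a⟫ = 0 := mem_orthogonal_iff.1 haT
  have := inner_le_supp hA ha (y + t • n)
  rwa [inner_add_right, real_inner_smul_right, real_inner_comm n a, h1, mul_zero, add_zero] at this

/-- With `supp_section_le`, this says that the minimum of h_A on the line y + ℝn is the support
function of the section at y. It is attained because y divided by that value lies in the polar of
the section and hence lifts to A°. -/
lemma exists_supp_add_smul_eq (hA : IsCompact A) (hconv : Convex ℝ A) (h0 : 0 ∈ interior A)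
    (hn : ‖n‖ = 1) {y : E d} (hy : y ∈ (Submodule.span ℝ {n})ᗮ) :
    ∃ t : ℝ, supp A (y + t • n) = supp (A ∩ (Submodule.span ℝ {n})ᗮ) y := by
  have h0A := interior_subset h0
  set T := (Submodule.span ℝ {n})ᗮ with hT
  rcases eq_or_ne y 0 with rfl | hy0
  · refine ⟨0, ?_⟩
    rw [zero_smul, add_zero, supp_zero hA ⟨0, h0A⟩,
      supp_zero (isCompact_section hA _) (section_nonempty h0A _)]
  have hpos : 0 < supp (A ∩ T) y := by
    obtain ⟨r, hr, hsub⟩ := Metric.mem_nhds_iff.1 (mem_interior_iff_mem_nhds.1 h0)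
    have hy' : 0 < ‖y‖ := norm_pos_iff.2 hy0
    have hmem : (r / 2 / ‖y‖) • y ∈ A := by
      apply hsub
      rw [mem_ball_zero_iff, norm_smul, Real.norm_of_nonneg (by positivity),
        div_mul_cancel₀ _ hy'.ne']
      linarith
    refine lt_of_lt_of_le ?_ (inner_le_supp (isCompact_section hA T)
      ⟨hmem, T.smul_mem _ hy⟩ y)
    rw [real_inner_smul_left, real_inner_self_eq_norm_sq]
    positivity
  set m := supp (A ∩ T) y with hm
  have hmem : m⁻¹ • y ∈ polarIn T (A ∩ T) := by
    refine ⟨T.smul_mem _ hy, fun a ha => ?_⟩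
    rw [real_inner_smul_right, inv_mul_le_iff₀ hpos, mul_one]
    exact inner_le_supp (isCompact_section hA T) ha y
  obtain ⟨t, ht⟩ := exists_add_smul_mem_polarBody hA hconv h0 hn hmem
  refine ⟨m * t, le_antisymm ?_ (supp_section_le hA h0A _)⟩
  rw [polarBody_eq_supp_le hA ⟨0, h0A⟩, mem_ofPred_eq] at ht
  have e : y + (m * t) • n = m • (m⁻¹ • y + t • n) := by
    rw [smul_add, smul_smul, smul_smul, mul_inv_cancel₀ hpos.ne', one_smul]
  rw [e, supp_smul hA ⟨0, h0A⟩ hpos.le]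
  exact mul_le_of_le_one_right hpos.le ht

lemma finrank_orthogonal_span (hn : ‖n‖ = 1) :
    Module.finrank ℝ (Submodule.span ℝ {n})ᗮ = d - 1 := by
  have hn0 : n ≠ 0 := fun h => by simp [h] at hn
  have h1 := (Submodule.span ℝ {n}).finrank_add_finrank_orthogonal
  rw [finrank_span_singleton hn0, finrank_euclideanSpace, Fintype.card_fin] at h1
  omega

lemma euclideanHausdorffMeasure_image_val (hn : ‖n‖ = 1)
    (s : Set (Submodule.span ℝ {n})ᗮ) :
    μHE[d - 1] (Subtype.val '' s : Set (E d)) = volume s := by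
  rw [isometry_subtype_coe.euclideanHausdorffMeasure_image, ← finrank_orthogonal_span hn,
    InnerProductSpace.euclideanHausdorffMeasure_eq_volume]

/-- Euclidean space as the product of a hyperplane and its normal line. -/
lemma measurePreserving_add_smul (hn : ‖n‖ = 1) :
    MeasurePreserving (fun p : (Submodule.span ℝ {n})ᗮ × ℝ => (p.1 : E d) + p.2 • n)
      ((volume : Measure (Submodule.span ℝ {n})ᗮ).prod volume) volume := by
  have h1 := ((Submodule.span ℝ {n}).measurePreserving_measurableEquivProd (0 : E d)).symm
  rw [InnerProductSpace.euclideanHausdorffMeasure_eq_volume] at h1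
  have h2 := (LinearIsometryEquiv.toSpanUnitSingleton (𝕜 := ℝ) n hn).measurePreserving
  have h3 := h2.prod (MeasurePreserving.id (volume : Measure (Submodule.span ℝ {n})ᗮ))
  have h4 := h1.comp (h3.comp Measure.measurePreserving_swap)
  have e : (fun p : (Submodule.span ℝ {n})ᗮ × ℝ => (p.1 : E d) + p.2 • n) =
      ((Submodule.span ℝ {n}).measurableEquivProd (0 : E d)).symm ∘
        Prod.map (LinearIsometryEquiv.toSpanUnitSingleton (𝕜 := ℝ) n hn) id ∘ Prod.swap := by
    funext p
    simp [add_comm]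
  rw [e]
  exact h4

lemma lintegral_hyperplane (hn : ‖n‖ = 1) {F : E d → ℝ≥0∞} (hF : Measurable F) :
    ∫⁻ x, F x = ∫⁻ y : (Submodule.span ℝ {n})ᗮ, ∫⁻ t : ℝ, F (y + t • n) := by
  rw [← (measurePreserving_add_smul hn).lintegral_comp hF, lintegral_prod]
  exact (hF.comp (measurePreserving_add_smul hn).measurable).aemeasurable

/-- Layer-cake integration of `(1 - m)⁺` for a `1`-homogeneous function `m`. -/
lemma lintegral_one_sub_homogeneous {F : Type*} [NormedAddCommGroup F] [InnerProductSpace ℝ F]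
    [FiniteDimensional ℝ F] [MeasurableSpace F] [BorelSpace F] {m : F → ℝ} (hm : Measurable m)
    (h0 : ∀ y, 0 ≤ m y) (hhom : ∀ y, ∀ t : ℝ, 0 < t → m (t • y) = t * m y) :
    ((Module.finrank ℝ F + 1 : ℕ) : ℝ≥0∞) * ∫⁻ y, ENNReal.ofReal (1 - m y) =
      volume {y | m y ≤ 1} := by
  set k := Module.finrank ℝ F
  have e1 : ∀ y, ENNReal.ofReal (1 - m y) = ENNReal.ofReal (max (1 - m y) 0) := fun y => by
    rcases le_total 0 (1 - m y) with h | h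
    · rw [max_eq_left h]
    · rw [max_eq_right h, ENNReal.ofReal_of_nonpos h, ENNReal.ofReal_zero]
  simp only [e1]
  rw [lintegral_eq_lintegral_meas_le (f := fun y => max (1 - m y) 0) _
    (Eventually.of_forall fun y => le_max_right _ _) (by fun_prop)]
  -- For 0 < t < 1 the superlevel set is the dilate of {m ≤ 1} by 1 - t. At t = 1 this dilation
  -- degenerates, but a single height is negligible.
  have e2 : ∀ t ∈ Ioi (0 : ℝ), t ≠ 1 → volume {y | t ≤ max (1 - m y) 0} =
      (Iic 1).indicator (fun t => ENNReal.ofReal ((1 - t) ^ k)) t * volume {y | m y ≤ 1} := by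
    intro t ht ht1
    have ht0 : 0 < t := ht
    rcases lt_or_gt_of_ne ht1 with hlt | hgt
    · rw [indicator_of_mem (show t ∈ Iic 1 from hlt.le),
        ← Measure.addHaar_smul_of_nonneg _ (by linarith)]
      congr 1
      ext y
      have hs : 0 < 1 - t := by linarith
      rw [mem_smul_set_iff_inv_smul_mem₀ hs.ne', mem_ofPred_eq, mem_ofPred_eq,
        hhom _ _ (inv_pos.2 hs), inv_mul_le_iff₀ hs, mul_one, le_max_iff]
      constructor
      · rintro (h | h) <;> linarith
      · intro h; left; linarith
    · rw [indicator_of_notMem (by simpa using hgt), zero_mul]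
      convert! measure_empty (μ := (volume : Measure F))
      ext y
      simp only [mem_ofPred_eq, mem_empty_iff_false, iff_false, not_le, max_lt_iff]
      exact ⟨by linarith [h0 y], ht0⟩
  have e3 : ∀ᵐ t ∂(volume.restrict (Ioi (0 : ℝ))), volume {y | t ≤ max (1 - m y) 0} =
      (Iic 1).indicator (fun t => ENNReal.ofReal ((1 - t) ^ k)) t * volume {y | m y ≤ 1} := by
    filter_upwards [ae_restrict_mem measurableSet_Ioi,
      ae_restrict_of_ae (Measure.ae_ne volume 1)] with t ht ht1 using e2 t ht ht1
  have e4 : ∫⁻ t in Ioc (0 : ℝ) 1, ENNReal.ofReal ((1 - t) ^ k) =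
      ENNReal.ofReal (1 / (k + 1)) := by
    rw [← ofReal_integral_eq_lintegral_ofReal, ← intervalIntegral.integral_of_le zero_le_one,
      intervalIntegral.integral_comp_sub_left (fun t => t ^ k), integral_pow]
    · simp
    · exact (Continuous.intervalIntegrable (by fun_prop) _ _).1
    · filter_upwards [ae_restrict_mem measurableSet_Ioc] with t ht
      exact pow_nonneg (by linarith [ht.2]) _
  rw [lintegral_congr_ae e3, lintegral_mul_const _ (Measurable.indicator (by fun_prop)
    measurableSet_Iic), lintegral_indicator measurableSet_Iic, Measure.restrict_restrict
    measurableSet_Iic, inter_comm, Ioi_inter_Iic, e4, ← mul_assoc, ← ENNReal.ofReal_natCast,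
    ← ENNReal.ofReal_mul (by positivity)]
  have : ((k + 1 : ℕ) : ℝ) * (1 / (k + 1)) = 1 := by
    push_cast
    field_simp
  rw [this, ENNReal.ofReal_one, one_mul]

lemma inner_gradient_eq_deriv {f : E d → ℝ} {y : E d} {t : ℝ}
    (hf : DifferentiableAt ℝ f (y + t • n)) :
    ⟪gradient f (y + t • n), n⟫ = deriv (fun t : ℝ => f (y + t • n)) t := by
  have h1 : HasDerivAt (fun t : ℝ => y + t • n) n t := by
    simpa using ((hasDerivAt_id t).smul_const n).const_add y
  have h2 := hf.hasFDerivAt.comp_hasDerivAt t h1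
  rw [gradient, InnerProductSpace.toDual_symm_apply]
  exact h2.deriv.symm

/-- The directional variation of the support function over the polar body equals the integral
over the hyperplane of the variation along lines. -/
lemma lintegral_abs_inner_gradient (hA : IsCompact A) (hconv : Convex ℝ A) (h0 : 0 ∈ interior A)
    (hn : ‖n‖ = 1) :
    ∫⁻ x in {x | supp A x ≤ 1}, ENNReal.ofReal |⟪gradient (supp A) x, n⟫| =
      ∫⁻ y : (Submodule.span ℝ {n})ᗮ,
        ENNReal.ofReal (2 * (1 - supp (A ∩ (Submodule.span ℝ {n})ᗮ) y)) := by
  have h0A := interior_subset h0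
  have hne : A.Nonempty := ⟨0, h0A⟩
  have hms : MeasurableSet {x | supp A x ≤ 1} :=
    measurableSet_le (continuous_supp hA hne).measurable measurable_const
  have hg := measurable_gradient (supp A)
  have hmF : Measurable fun x => ENNReal.ofReal |⟪gradient (supp A) x, n⟫| := by
    have h1 : Measurable fun x => ⟪gradient (supp A) x, n⟫ := hg.inner measurable_const
    exact h1.abs.ennreal_ofReal
  obtain ⟨C, hC⟩ := exists_lipschitzWith_supp hA hne
  rw [← lintegral_indicator hms, lintegral_hyperplane hn (hmF.indicator hms)]
  -- By Rademacher and Fubini, on almost every line parallel to n the function h_A is differentiable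
  -- at almost every point.
  have hae := Measure.ae_ae_of_ae_prod
    ((measurePreserving_add_smul hn).quasiMeasurePreserving.ae (ae_differentiableAt_supp hA hne))
  refine lintegral_congr_ae ?_
  filter_upwards [hae] with y hy
  set f : ℝ → ℝ := fun t => supp A (y + t • n) with hf
  have hflip : LipschitzWith C f := by
    refine LipschitzWith.of_dist_le_mul fun s t => (hC.dist_le_mul _ _).trans ?_
    rw [dist_add_left, dist_eq_norm, ← sub_smul, norm_smul, hn, mul_one, ← dist_eq_norm]
  have hfconv : ConvexOn ℝ univ f := by
    refine ⟨convex_univ, fun s _ t _ a b ha hb hab => ?_⟩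
    have := (convexOn_supp hA hne).2 (mem_univ (y + s • n : E d)) (mem_univ (y + t • n)) ha hb hab
    convert! this using 2
    have : (y : E d) = a • (y : E d) + b • (y : E d) := by rw [← add_smul, hab, one_smul]
    conv_lhs => rw [this]
    simp only [smul_eq_mul, smul_add, add_smul, mul_smul]
    abel
  obtain ⟨t₀, ht₀⟩ := exists_supp_add_smul_eq hA hconv h0 hn y.2
  have hmin : ∀ t, f t₀ ≤ f t := fun t => ht₀.trans_le (supp_section_le hA h0A t)
  obtain ⟨r, hr, hrb⟩ := exists_mul_norm_le_supp hA h0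
  -- Linear growth of h_A forces f ≥ 1 far out on both sides, so the variation over the sublevel set
  -- counts a full descent and a full ascent.
  have hbig : ∀ t : ℝ, ‖(y : E d)‖ + 1 / r ≤ |t| → 1 ≤ f t := by
    intro t ht
    have h1 : |t| - ‖(y : E d)‖ ≤ ‖(y : E d) + t • n‖ := by
      have := norm_sub_norm_le (t • n) (-(y : E d))
      rw [norm_smul, hn, mul_one, norm_neg, sub_neg_eq_add, add_comm (t • n)] at this
      exact this
    have h2 : 1 / r ≤ ‖(y : E d) + t • n‖ := by linarith
    rw [div_le_iff₀' hr] at h2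
    exact h2.trans (hrb _)
  have hyr : 0 ≤ ‖(y : E d)‖ + 1 / r := by positivity
  have key := lintegral_abs_deriv_sublevel hfconv hflip hmin
    ⟨max t₀ (‖(y : E d)‖ + 1 / r), le_max_left _ _, hbig _ ((le_max_right _ _).trans (le_abs_self _))⟩
    ⟨min t₀ (-(‖(y : E d)‖ + 1 / r)), min_le_left _ _, hbig _ (by
      rw [le_abs]; right; linarith [min_le_right t₀ (-(‖(y : E d)‖ + 1 / r))])⟩
  rw [← ht₀]
  change _ = ENNReal.ofReal (2 * (1 - f t₀))
  rw [← key, ← lintegral_indicator (measurableSet_le hflip.continuous.measurable measurable_const)]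
  refine lintegral_congr_ae ?_
  filter_upwards [hy] with t ht
  simp only [indicator]
  refine if_congr Iff.rfl ?_ rfl
  rw [inner_gradient_eq_deriv ht]

/-- The area of the polar of a hyperplane section, as an integral over directions. -/
lemma two_mul_area_polarIn_section (hd : 0 < d) (hA : IsCompact A) (hconv : Convex ℝ A)
    (h0 : 0 ∈ interior A) (hn : ‖n‖ = 1) :
    2 * μHE[d - 1] (polarIn (Submodule.span ℝ {n})ᗮ (A ∩ (Submodule.span ℝ {n})ᗮ)) =
      ∫⁻ θ, ENNReal.ofReal |⟪gradient (supp A) θ.1, n⟫| * ENNReal.ofReal ((supp A θ.1 ^ d)⁻¹)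
        ∂(sphereMeasure d) := by
  have h0A := interior_subset h0
  have hne : A.Nonempty := ⟨0, h0A⟩
  have hT := isCompact_section hA (Submodule.span ℝ {n})ᗮ
  have hTne := section_nonempty h0A (Submodule.span ℝ {n})ᗮ
  have hmF : Measurable fun x => ENNReal.ofReal |⟪gradient (supp A) x, n⟫| := by
    have h1 : Measurable fun x => ⟪gradient (supp A) x, n⟫ :=
      (measurable_gradient (supp A)).inner measurable_const
    exact h1.abs.ennreal_ofReal
  rw [← setLIntegral_homogeneous hd (continuous_supp hA hne).measurable
    (fun w t ht => supp_smul hA hne ht.le w) (fun θ => supp_pos hA h0 (sphere_ne_zero θ)) hmF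
    (fun x t ht => by simp only [gradient_supp_smul hA hne ht]),
    lintegral_abs_inner_gradient hA hconv h0 hn, polarIn_section_eq hA h0A,
    euclideanHausdorffMeasure_image_val hn]
  have hl := lintegral_one_sub_homogeneous (F := (Submodule.span ℝ {n})ᗮ)
    (m := fun y => supp (A ∩ (Submodule.span ℝ {n})ᗮ) y)
    ((continuous_supp hT hTne).comp continuous_subtype_val).measurable
    (fun y => supp_nonneg hT ⟨h0A, Submodule.zero_mem _⟩ _)
    (fun y t ht => supp_smul hT hTne ht.le _)
  -- The layer-cake factor (d - 1) + 1 is exactly the factor d from polar integration.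
  rw [finrank_orthogonal_span hn, Nat.sub_add_cancel hd] at hl
  rw [← hl]
  simp only [ENNReal.ofReal_mul (zero_le_two (α := ℝ))]
  rw [lintegral_const_mul' _ _ ENNReal.ofReal_ne_top]
  simp only [ENNReal.ofReal_ofNat]
  ring

end Hyperplane

/-! ### Tools for local comparison of measures, and cones over flat pieces. -/

section LocalComparison

lemma euclideanHausdorffMeasure_image_le {c : NNReal} {f : E d → E d} {s : Set (E d)}
    (hf : LipschitzOnWith c f s) (k : ℕ) : μHE[k] (f '' s) ≤ (c : ℝ≥0∞) ^ k * μHE[k] s := by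
  have h := hf.hausdorffMeasure_image_le (d := k) (by positivity)
  rw [ENNReal.rpow_natCast] at h
  rw [Measure.euclideanHausdorffMeasure_def, Measure.smul_apply, Measure.smul_apply,
    ENNReal.smul_def, ENNReal.smul_def, smul_eq_mul, smul_eq_mul, mul_left_comm]
  gcongr

/-- Measures that compare on sets with small image under a measurable map to a separable metric
space compare globally. -/
lemma measure_le_of_locally_le {X Y : Type*} [MeasurableSpace X] [MetricSpace Y]
    [TopologicalSpace.SeparableSpace Y] [Nonempty Y] [MeasurableSpace Y] [BorelSpace Y]
    {μ ν : Measure X} {f : X → Y} (hf : Measurable f) {S : Set X} {C : ℝ≥0∞} {δ : ℝ} (hδ : 0 < δ)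
    (h : ∀ B ⊆ S, MeasurableSet B → (∀ x ∈ B, ∀ y ∈ B, dist (f x) (f y) ≤ δ) → μ B ≤ C * ν B)
    {B : Set X} (hBS : B ⊆ S) (hB : MeasurableSet B) : μ B ≤ C * ν B := by
  set U : ℕ → Set X := fun n => f ⁻¹' ball (TopologicalSpace.denseSeq Y n) (δ / 2)
  have hU : ∀ n, MeasurableSet (U n) := fun n => hf measurableSet_ball
  have hcover : ⋃ n, disjointed U n = univ := by
    rw [iUnion_disjointed, eq_univ_iff_forall]
    intro x
    obtain ⟨n, hn⟩ := (TopologicalSpace.denseRange_denseSeq Y).exists_dist_lt (f x)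
      (half_pos hδ)
    exact mem_iUnion.2 ⟨n, hn⟩
  have hBu : B = ⋃ n, B ∩ disjointed U n := by
    rw [← inter_iUnion, hcover, inter_univ]
  have hm : ∀ n, MeasurableSet (B ∩ disjointed U n) := fun n =>
    hB.inter (MeasurableSet.disjointed hU n)
  have hdisj : Pairwise (Function.onFun Disjoint fun n => B ∩ disjointed U n) := fun i j hij =>
    (disjoint_disjointed U hij).mono inter_subset_right inter_subset_right
  have e : ∀ m : Measure X, m B = ∑' n, m (B ∩ disjointed U n) := fun m => by
    conv_lhs => rw [hBu]
    exact measure_iUnion hdisj hm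
  rw [e μ, e ν, ← ENNReal.tsum_mul_left]
  refine ENNReal.tsum_le_tsum fun n => h _ (inter_subset_left.trans hBS) (hm n) ?_
  intro x hx y hy
  have h1 : dist (f x) _ < δ / 2 := disjointed_subset U n hx.2
  have h2 : dist (f y) _ < δ / 2 := disjointed_subset U n hy.2
  exact (dist_triangle_right _ _ _).trans (by linarith)

lemma le_of_forall_one_lt_pow_mul {a b : ℝ≥0∞} {k : ℕ}
    (h : ∀ c : NNReal, 1 < c → a ≤ (c : ℝ≥0∞) ^ k * b) : a ≤ b := by
  have h1 : Tendsto (fun c : NNReal => ((c : ℝ≥0∞) ^ k) * b) (𝓝[>] 1) (𝓝 (1 * b)) := by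
    refine ENNReal.Tendsto.mul_const ?_ (Or.inl one_ne_zero)
    have h2 : Tendsto (fun c : NNReal => (c : ℝ≥0∞) ^ k) (𝓝 1) (𝓝 (((1 : NNReal) : ℝ≥0∞) ^ k)) :=
      ((ENNReal.continuous_pow k).comp ENNReal.continuous_coe).tendsto 1
    simpa using h2.mono_left nhdsWithin_le_nhds
  rw [one_mul] at h1
  exact ge_of_tendsto h1 (by filter_upwards [self_mem_nhdsWithin] with c hc using h c hc)

/-- The volume of the cone over a subset of an affine hyperplane. -/
lemma volume_cone_hyperplane (hd : 0 < d) {p : E d} (hp : p ≠ 0) {B : Set (E d)}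
    (hB : MeasurableSet B) (hBp : ∀ z ∈ B, ⟪p, z⟫ = 1) :
    d * volume (Ioc (0 : ℝ) 1 • B) = ENNReal.ofReal ‖p‖⁻¹ * μHE[d - 1] B := by
  have hp' : 0 < ‖p‖ := norm_pos_iff.2 hp
  have hset : Ioc (0 : ℝ) 1 • B = {z | ⟪p, z⟫ ∈ Ioc (0 : ℝ) 1} ∩ {z | ⟪p, z⟫⁻¹ • z ∈ B} := by
    ext z
    constructor
    · rintro ⟨t, ht, b, hb, rfl⟩
      have e : ⟪p, t • b⟫ = t := by rw [real_inner_smul_right, hBp b hb, mul_one]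
      refine ⟨by rwa [mem_ofPred_eq, e], ?_⟩
      rwa [mem_ofPred_eq, e, smul_smul, inv_mul_cancel₀ ht.1.ne', one_smul]
    · rintro ⟨h1, h2⟩
      exact ⟨_, h1, _, h2, by simp only [smul_smul, mul_inv_cancel₀ h1.1.ne', one_smul]⟩
  have hmeas : MeasurableSet (Ioc (0 : ℝ) 1 • B) := by
    rw [hset]
    have h1 : Measurable fun z : E d => ⟪p, z⟫ := Continuous.measurable (by fun_prop)
    exact (h1 measurableSet_Ioc).inter ((h1.inv.smul measurable_id) hB)
  have hslice := EuclideanGeometry.euclideanHausdorffMeasure_eq_lintegral (0 : E d) hp hmeas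
  rw [InnerProductSpace.euclideanHausdorffMeasure_eq_volume, finrank_euclideanSpace,
    Fintype.card_fin] at hslice
  -- On the slice through x • p the functional ⟪p, ·⟫ equals x‖p‖², so the slice is the dilate of
  -- `B` by that factor if 0 < x ≤ ‖p‖⁻², and empty otherwise.
  have hint : ∀ x : ℝ, μHE[d - 1] (Ioc (0 : ℝ) 1 • B ∩
      AffineSubspace.mk' (x • p +ᵥ (0 : E d)) (Submodule.span ℝ {p})ᗮ) =
      (Ioc 0 ((‖p‖ ^ 2)⁻¹)).indicator (fun x => ENNReal.ofReal (x ^ (d - 1)) *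
        (ENNReal.ofReal ((‖p‖ ^ 2) ^ (d - 1)) * μHE[d - 1] B)) x := by
    intro x
    have hmem : ∀ z, z ∈ (AffineSubspace.mk' (x • p +ᵥ (0 : E d)) (Submodule.span ℝ {p})ᗮ) ↔
        ⟪p, z⟫ = x * ‖p‖ ^ 2 := fun z => by
      rw [AffineSubspace.mem_mk', mem_orthogonal_iff, vadd_eq_add, add_zero, vsub_eq_sub,
        inner_sub_right, real_inner_smul_right, real_inner_self_eq_norm_sq, sub_eq_zero]
    by_cases hx : x ∈ Ioc 0 ((‖p‖ ^ 2)⁻¹)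
    · have hs : 0 < x * ‖p‖ ^ 2 := mul_pos hx.1 (by positivity)
      have hs1 : x * ‖p‖ ^ 2 ≤ 1 := by
        have := hx.2
        rwa [← one_div, le_div_iff₀ (by positivity)] at this
      rw [indicator_of_mem hx]
      have e : Ioc (0 : ℝ) 1 • B ∩
          AffineSubspace.mk' (x • p +ᵥ (0 : E d)) (Submodule.span ℝ {p})ᗮ =
          (x * ‖p‖ ^ 2) • B := by
        ext z
        rw [mem_smul_set_iff_inv_smul_mem₀ hs.ne']
        constructor
        · rintro ⟨h1, h2⟩
          rw [hset] at h1
          rw [← (hmem z).1 h2]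
          exact h1.2
        · intro h1
          have h2 : ⟪p, z⟫ = x * ‖p‖ ^ 2 := by
            have := hBp _ h1
            rwa [real_inner_smul_right, inv_mul_eq_one₀ hs.ne', eq_comm] at this
          refine ⟨?_, (hmem z).2 h2⟩
          rw [hset]
          refine ⟨?_, ?_⟩ <;> rw [mem_ofPred_eq, h2]
          · exact ⟨hs, hs1⟩
          · exact h1
      rw [e, Measure.euclideanHausdorffMeasure_smul₀ _ hs.ne', ENNReal.smul_def, smul_eq_mul,
        ← mul_assoc, ← ENNReal.ofReal_mul (pow_nonneg hx.1.le _), ← mul_pow, ENNReal.coe_pow,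
        ENNReal.ofReal_pow hs.le]
      congr 2
      rw [← enorm_eq_nnnorm, ← ofReal_norm, Real.norm_of_nonneg hs.le]
    · rw [indicator_of_notMem hx]
      convert! measure_empty (μ := (μHE[d - 1] : Measure (E d)))
      rw [eq_empty_iff_forall_notMem]
      rintro z ⟨h1, h2⟩
      rw [hset] at h1
      have h3 := h1.1
      rw [mem_ofPred_eq, (hmem z).1 h2] at h3
      refine hx ⟨pos_of_mul_pos_left h3.1 (by positivity), ?_⟩
      rw [← one_div, le_div_iff₀ (by positivity)]
      exact h3.2
  rw [hslice]
  simp only [hint]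
  rw [lintegral_indicator measurableSet_Ioc, lintegral_mul_const _ (by fun_prop),
    lintegral_Ioc_pow hd (by positivity), ← ofReal_norm, ← ENNReal.ofReal_natCast,
    ← mul_assoc, ← mul_assoc, ← mul_assoc, ← ENNReal.ofReal_mul (by positivity),
    ← ENNReal.ofReal_mul (by positivity), ← ENNReal.ofReal_mul (by positivity)]
  congr 2
  obtain ⟨k, rfl⟩ : ∃ k, d = k + 1 := ⟨d - 1, by omega⟩
  have : ((k + 1 : ℕ) : ℝ) ≠ 0 := by positivity
  rw [Nat.add_sub_cancel, inv_pow, pow_succ (‖p‖ ^ 2)]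
  field_simp

end LocalComparison

/-! ### Cone measure equals weighted surface measure. -/

section SurfaceMeasure

variable {P : Set (E d)}

/-- The set of points of the level surface `{supp P = 1}` at which `supp P` is differentiable. -/
def smoothLevel (P : Set (E d)) : Set (E d) :=
  {x | supp P x = 1 ∧ DifferentiableAt ℝ (supp P) x}

lemma measurableSet_smoothLevel (hP : IsCompact P) (hne : P.Nonempty) :
    MeasurableSet (smoothLevel P) :=
  (measurableSet_eq_fun (continuous_supp hP hne).measurable measurable_const).inter
    (measurableSet_of_differentiableAt ℝ _)

/-- The cone measure on the level surface `{supp P = 1}`. -/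
noncomputable def coneMeasure (P : Set (E d)) : Measure (E d) :=
  (d : ℝ≥0∞) • ((volume.restrict {z | supp P z ≤ 1}).map fun z => (supp P z)⁻¹ • z)

lemma measurable_radialProjection (hP : IsCompact P) (hne : P.Nonempty) :
    Measurable fun z : E d => (supp P z)⁻¹ • z :=
  (continuous_supp hP hne).measurable.inv.smul measurable_id

/-- The points of the unit ball of h_P that project radially into `B` form the cone over `B` without
its apex. -/
lemma coneMeasure_apply (hP : IsCompact P) (hne : P.Nonempty) {B : Set (E d)}
    (hB : MeasurableSet B) (hB1 : ∀ x ∈ B, supp P x = 1) (h0 : 0 ∈ P) :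
    coneMeasure P B = d * volume (Ioc (0 : ℝ) 1 • B) := by
  have hm := measurable_radialProjection hP hne
  rw [coneMeasure, Measure.smul_apply, Measure.map_apply hm hB, smul_eq_mul,
    Measure.restrict_apply (hm hB)]
  congr 2
  ext z
  constructor
  · rintro ⟨h1, h2⟩
    have hz : supp P z ≠ 0 := fun h => by
      have : supp P ((supp P z)⁻¹ • z) = 1 := hB1 _ h1
      rw [h, inv_zero, zero_smul, supp_zero hP hne] at this
      exact zero_ne_one this
    exact ⟨_, ⟨lt_of_le_of_ne (supp_nonneg hP h0 z) hz.symm, h2⟩, _, h1, by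
      simp only [smul_smul, mul_inv_cancel₀ hz, one_smul]⟩
  · rintro ⟨t, ht, b, hb, rfl⟩
    have e : supp P (t • b) = t := by rw [supp_smul hP hne ht.1.le, hB1 b hb, mul_one]
    refine ⟨?_, ?_⟩
    · rwa [mem_preimage, e, smul_smul, inv_mul_cancel₀ ht.1.ne', one_smul]
    · rw [mem_ofPred_eq, e]; exact ht.2

/-- Central projection to the hyperplane `{⟪p, ·⟫ = 1}` distorts distances little on a set that
is nearly parallel to and close to that hyperplane. -/
lemma norm_central_projection_bounds {p x x' : E d} {R η : ℝ} (hη0 : 0 < η) (hη : η ≤ 1 / 2)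
    (hR : 0 < R) (hx' : ‖x'‖ ≤ R)
    (h1 : |⟪p, x⟫ - 1| ≤ η) (h2 : |⟪p, x'⟫ - 1| ≤ η)
    (h3 : |⟪p, x - x'⟫| ≤ η / (2 * R) * ‖x - x'‖) :
    ‖⟪p, x⟫⁻¹ • x - ⟪p, x'⟫⁻¹ • x'‖ ≤ ((1 - η)⁻¹) ^ 2 * ‖x - x'‖ ∧
      ‖x - x'‖ ≤ ((1 - η)⁻¹) ^ 2 * ‖⟪p, x⟫⁻¹ • x - ⟪p, x'⟫⁻¹ • x'‖ := by
  set s := ⟪p, x⟫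
  set s' := ⟪p, x'⟫
  rw [inner_sub_right] at h3
  change |s - s'| ≤ _ at h3
  obtain ⟨h1l, h1u⟩ := abs_le.1 h1
  obtain ⟨h2l, h2u⟩ := abs_le.1 h2
  have hq : 0 < 1 - η := by linarith
  have hs : 0 < s := by linarith
  have hs' : 0 < s' := by linarith
  have hinv : s⁻¹ ≤ (1 - η)⁻¹ := inv_anti₀ hq (by linarith)
  have hinv' : s'⁻¹ ≤ (1 - η)⁻¹ := inv_anti₀ hq (by linarith)
  have hq1 : (1 - η) * (1 - η)⁻¹ = 1 := mul_inv_cancel₀ hq.ne'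
  set k := (1 - η)⁻¹
  have hk : 0 < k := inv_pos.2 hq
  set D := ‖x - x'‖
  have hD : 0 ≤ D := norm_nonneg _
  have hRx : |s - s'| * ‖x'‖ ≤ η / 2 * D := by
    calc |s - s'| * ‖x'‖ ≤ (η / (2 * R) * D) * R := by gcongr
      _ = η / 2 * D := by field_simp
  constructor
  -- The difference of projections is the scaled difference x - x' plus an error proportional to s -
  -- s', which near-parallelism makes at most η/2 times ‖x - x'‖ once multiplied by ‖x'‖.
  · have e : s⁻¹ • x - s'⁻¹ • x' = s⁻¹ • ((x - x') - (s'⁻¹ * (s - s')) • x') := by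
      rw [smul_sub, smul_sub, smul_smul, sub_sub, ← add_smul]
      congr 2
      field_simp
      ring
    have h4 : ‖(s'⁻¹ * (s - s')) • x'‖ ≤ k * (η / 2 * D) := by
      rw [norm_smul, norm_mul, Real.norm_of_nonneg (inv_pos.2 hs').le, Real.norm_eq_abs, mul_assoc]
      gcongr
    rw [e, norm_smul, Real.norm_of_nonneg (inv_pos.2 hs).le]
    calc s⁻¹ * ‖(x - x') - (s'⁻¹ * (s - s')) • x'‖ ≤ k * (D + k * (η / 2 * D)) := by
          gcongr
          exact (norm_sub_le _ _).trans (by gcongr)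
      _ = k * D * (1 + k * η / 2) := by ring
      -- This uses k = 1 + kη, a restatement of (1 - η)k = 1.
      _ ≤ k * D * k := by
          gcongr
          nlinarith
      _ = k ^ 2 * D := by ring
  · set y := s⁻¹ • x - s'⁻¹ • x'
    have e : x - x' = s • y + (s'⁻¹ * (s - s')) • x' := by
      simp only [y, smul_sub, smul_smul, mul_inv_cancel₀ hs.ne', one_smul]
      rw [sub_add, ← sub_smul]
      congr 1
      have : s * s'⁻¹ - s'⁻¹ * (s - s') = 1 := by field_simp; ring
      rw [this, one_smul]
    have h4 : ‖(s'⁻¹ * (s - s')) • x'‖ ≤ k * (η / 2 * D) := by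
      rw [norm_smul, norm_mul, Real.norm_of_nonneg (inv_pos.2 hs').le, Real.norm_eq_abs, mul_assoc]
      gcongr
    have h5 : D ≤ (1 + η) * ‖y‖ + k * (η / 2 * D) := by
      calc D = ‖s • y + (s'⁻¹ * (s - s')) • x'‖ := by rw [← e]
        _ ≤ ‖s • y‖ + ‖(s'⁻¹ * (s - s')) • x'‖ := norm_add_le _ _
        _ ≤ (1 + η) * ‖y‖ + k * (η / 2 * D) := by
            rw [norm_smul, Real.norm_of_nonneg hs.le]
            gcongr
            linarith
    have h6 : k ≤ 2 := by
      rw [show (2 : ℝ) = (1 / 2)⁻¹ by norm_num]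
      exact inv_anti₀ (by norm_num) (by linarith)
    have h7 : (1 - η) * D ≤ (1 + η) * ‖y‖ := by
      have : k * (η / 2 * D) ≤ 2 * (η / 2 * D) := by gcongr
      linarith
    have h8 : D ≤ k * ((1 + η) * ‖y‖) := by
      calc D = k * ((1 - η) * D) := by rw [← mul_assoc, mul_comm k, hq1, one_mul]
        _ ≤ _ := by gcongr
    have h9 : 1 + η ≤ k := by nlinarith
    calc D ≤ k * ((1 + η) * ‖y‖) := h8
      _ ≤ k * (k * ‖y‖) := by gcongr
      _ = k ^ 2 * ‖y‖ := by ring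

/-- The surface measure on `{supp P = 1}`, weighted by the distance of the tangent plane to the
origin. -/
noncomputable def weightedSurfaceMeasure (P : Set (E d)) : Measure (E d) :=
  (μHE[d - 1] : Measure (E d)).withDensity fun x => ENNReal.ofReal ‖gradient (supp P) x‖⁻¹

lemma measurable_inv_norm_gradient (P : Set (E d)) :
    Measurable fun x => ENNReal.ofReal ‖gradient (supp P) x‖⁻¹ :=
  (measurable_gradient (supp P)).norm.inv.ennreal_ofReal

/-- On sets where the normal varies little, the cone measure and the weighted surface measure
nearly agree. -/
lemma coneMeasure_locally_close (hd : 0 < d) (hP : IsCompact P) (h0 : 0 ∈ interior P)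
    {c : NNReal} (hc : 1 < c) :
    ∃ δ > 0, ∀ B ⊆ smoothLevel P, MeasurableSet B →
      (∀ x ∈ B, ∀ y ∈ B, dist (gradient (supp P) x) (gradient (supp P) y) ≤ δ) →
      coneMeasure P B ≤ (c : ℝ≥0∞) ^ (2 * d) * weightedSurfaceMeasure P B ∧
      weightedSurfaceMeasure P B ≤ (c : ℝ≥0∞) ^ (2 * d) * coneMeasure P B := by
  have h0P := interior_subset h0
  have hne : P.Nonempty := ⟨0, h0P⟩
  obtain ⟨r, hr, hrb⟩ := exists_mul_norm_le_supp hP h0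
  set R : ℝ := 1 / r with hRdef
  have hR : 0 < R := by positivity
  have hbound : ∀ x, supp P x = 1 → ‖x‖ ≤ R := fun x hx => by
    rw [hRdef, le_div_iff₀' hr, ← hx]
    exact hrb x
  have hc' : (1 : ℝ) < c := by exact_mod_cast hc
  have hc0 : (0 : ℝ) < c := by linarith
  -- Chosen so that c⁻¹ = 1 - 2η ≤ (1 - η)²; the distortion (1 - η)⁻² of the central projection is
  -- then at most c.
  set η : ℝ := (1 - (c : ℝ)⁻¹) / 2 with hηdef
  have hcinv : (c : ℝ)⁻¹ < 1 := inv_lt_one_of_one_lt₀ hc'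
  have hcinv0 : 0 < (c : ℝ)⁻¹ := inv_pos.2 hc0
  have hη0 : 0 < η := by rw [hηdef]; linarith
  have hη : η ≤ 1 / 2 := by rw [hηdef]; linarith
  have hq : 0 < 1 - η := by linarith
  have hsq : (c : ℝ)⁻¹ ≤ (1 - η) ^ 2 := by
    have : (c : ℝ)⁻¹ = 1 - 2 * η := by rw [hηdef]; ring
    nlinarith
  have hk2 : ((1 - η)⁻¹) ^ 2 ≤ c := by
    rw [inv_pow]
    exact inv_le_of_inv_le₀ hc0 hsq
  have hk1 : (1 - η)⁻¹ ≤ c := by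
    refine le_trans ?_ hk2
    have : 1 ≤ (1 - η)⁻¹ := (one_le_inv₀ hq).2 (by linarith)
    nlinarith
  have hηc : 1 + η ≤ c := by
    refine le_trans ?_ hk1
    rw [le_inv_comm₀ (by linarith) hq, ← one_div, le_div_iff₀ (by linarith)]
    nlinarith
  -- `R` bounds the level surface, whose diameter is thus at most 2R; this δ is the slope allowed in
  -- `norm_central_projection_bounds`.
  refine ⟨η / (2 * R), by positivity, fun B hBS hB hδ => ?_⟩
  rcases B.eq_empty_or_nonempty with rfl | ⟨x₀, hx₀⟩
  · simp
  set p := gradient (supp P) x₀ with hp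
  have hgrad : ∀ x ∈ B, gradient (supp P) x ∈ P ∧ ⟪gradient (supp P) x, x⟫ = 1 := fun x hx =>
    ⟨gradient_supp_mem hP hne (hBS hx).2,
      (inner_gradient_supp hP hne (hBS hx).2).trans (hBS hx).1⟩
  have hp0 : p ≠ 0 := fun h => by
    have := (hgrad x₀ hx₀).2
    rw [← hp, h, inner_zero_left] at this
    exact zero_ne_one this
  have hp' : 0 < ‖p‖ := norm_pos_iff.2 hp0
  -- The supporting inequality at x gives ⟪∇h_P(x), y - x⟫ ≤ 0, and replacing ∇h_P(x) by p costs at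
  -- most δ‖x - y‖. Exchanging x and y gives the two-sided bound.
  have hflat1 : ∀ x ∈ B, ∀ y ∈ B, ⟪p, y - x⟫ ≤ η / (2 * R) * ‖x - y‖ := by
    intro x hx y hy
    have e1 : ⟪gradient (supp P) x, y⟫ ≤ 1 := (inner_le_supp hP (hgrad x hx).1 y).trans_eq (hBS hy).1
    have e2 : ⟪p - gradient (supp P) x, y - x⟫ ≤ η / (2 * R) * ‖x - y‖ := by
      refine (real_inner_le_norm _ _).trans ?_
      rw [norm_sub_rev y x, ← dist_eq_norm p]
      exact mul_le_mul_of_nonneg_right (hδ x₀ hx₀ x hx) (norm_nonneg _)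
    rw [inner_sub_left, inner_sub_right (gradient (supp P) x), (hgrad x hx).2] at e2
    linarith
  have hflat : ∀ x ∈ B, ∀ y ∈ B, |⟪p, x - y⟫| ≤ η / (2 * R) * ‖x - y‖ := by
    intro x hx y hy
    rw [abs_le]
    have e1 := hflat1 x hx y hy
    have e2 := hflat1 y hy x hx
    rw [← neg_sub x y, inner_neg_right] at e1
    rw [norm_sub_rev] at e2
    exact ⟨by linarith, e2⟩
  have hone : ∀ x ∈ B, |⟪p, x⟫ - 1| ≤ η := by
    intro x hx
    have e1 := hflat x hx x₀ hx₀
    rw [inner_sub_right, (hgrad x₀ hx₀).2] at e1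
    refine e1.trans ?_
    have e2 : ‖x - x₀‖ ≤ 2 * R := by
      have := norm_sub_le x x₀
      linarith [hbound x (hBS hx).1, hbound x₀ (hBS hx₀).1]
    calc η / (2 * R) * ‖x - x₀‖ ≤ η / (2 * R) * (2 * R) := by gcongr
      _ = η := by field_simp
  have hsupp : ∀ x ∈ B, supp P x = 1 := fun x hx => (hBS hx).1
  have hspos : ∀ x ∈ B, 0 < ⟪p, x⟫ := fun x hx => by
    have := (abs_le.1 (hone x hx)).1
    linarith
  have hratio : ∀ x ∈ B, ‖gradient (supp P) x‖ ≤ c * ‖p‖ ∧ ‖p‖ ≤ c * ‖gradient (supp P) x‖ := by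
    intro x hx
    have e1 : ‖p - gradient (supp P) x‖ ≤ η / (2 * R) := by
      rw [← dist_eq_norm]; exact hδ x₀ hx₀ x hx
    have e2 : 1 ≤ ‖p‖ * R := by
      have := real_inner_le_norm p x₀
      rw [(hgrad x₀ hx₀).2] at this
      exact this.trans (mul_le_mul_of_nonneg_left (hbound x₀ (hBS hx₀).1) (norm_nonneg _))
    have e3 : η / (2 * R) ≤ η * ‖p‖ := by
      rw [div_le_iff₀ (by positivity)]
      nlinarith
    have e4 := norm_sub_norm_le p (gradient (supp P) x)
    have e5 := norm_sub_norm_le (gradient (supp P) x) p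
    rw [norm_sub_rev] at e5
    constructor
    · calc ‖gradient (supp P) x‖ ≤ (1 + η) * ‖p‖ := by linarith
        _ ≤ c * ‖p‖ := by gcongr
    · have e6 : (1 - η) * ‖p‖ ≤ ‖gradient (supp P) x‖ := by linarith
      calc ‖p‖ = (1 - η)⁻¹ * ((1 - η) * ‖p‖) := by
            rw [← mul_assoc, inv_mul_cancel₀ hq.ne', one_mul]
        _ ≤ c * ‖gradient (supp P) x‖ := by gcongr
  -- π projects centrally to the hyperplane {⟪p, ·⟫ = 1} and ψ projects back to the level surface.
  set π : E d → E d := fun x => ⟪p, x⟫⁻¹ • x with hπ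
  set ψ : E d → E d := fun z => (supp P z)⁻¹ • z with hψ
  have hψπ : ∀ x ∈ B, ψ (π x) = x := fun x hx => by
    have := hspos x hx
    simp only [hψ, hπ]
    rw [supp_smul hP hne (inv_pos.2 this).le, hsupp x hx, mul_one, inv_inv, smul_smul,
      mul_inv_cancel₀ this.ne', one_smul]
  have hπp : ∀ z ∈ π '' B, ⟪p, z⟫ = 1 := by
    rintro _ ⟨x, hx, rfl⟩
    rw [hπ, real_inner_smul_right, inv_mul_cancel₀ (hspos x hx).ne']
  have hπB : MeasurableSet (π '' B) := by
    -- Measurability of the image is read off from its description as a preimage under the inverse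
    -- map ψ.
    have e : π '' B = {z | ⟪p, z⟫ = 1} ∩ {z | 0 < supp P z} ∩ ψ ⁻¹' B := by
      ext z
      constructor
      · intro hz
        refine ⟨⟨hπp z hz, ?_⟩, ?_⟩
        · obtain ⟨x, hx, rfl⟩ := hz
          rw [mem_ofPred_eq, hπ, supp_smul hP hne (inv_pos.2 (hspos x hx)).le, hsupp x hx, mul_one]
          exact inv_pos.2 (hspos x hx)
        · obtain ⟨x, hx, rfl⟩ := hz
          rwa [mem_preimage, hψπ x hx]
      · rintro ⟨⟨h1, h2⟩, h3⟩
        refine ⟨_, h3, ?_⟩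
        have h1' : ⟪p, z⟫ = 1 := h1
        have h2' : 0 < supp P z := h2
        simp only [hπ, hψ]
        rw [real_inner_smul_right, h1', mul_one, inv_inv, smul_smul, mul_inv_cancel₀ h2'.ne',
          one_smul]
    rw [e]
    have h1 : Measurable fun z : E d => ⟪p, z⟫ := Continuous.measurable (by fun_prop)
    exact ((measurableSet_eq_fun h1 measurable_const).inter
      (measurableSet_lt measurable_const (continuous_supp hP hne).measurable)).inter
      (measurable_radialProjection hP hne hB)
  have hbd : ∀ x ∈ B, ∀ y ∈ B, ‖π x - π y‖ ≤ c * ‖x - y‖ ∧ ‖x - y‖ ≤ c * ‖π x - π y‖ := by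
    intro x hx y hy
    obtain ⟨h1, h2⟩ := norm_central_projection_bounds hη0 hη hR (hbound y (hBS hy).1)
      (hone x hx) (hone y hy) (hflat x hx y hy)
    exact ⟨h1.trans (by gcongr), h2.trans (by gcongr)⟩
  have hH1 : μHE[d - 1] (π '' B) ≤ (c : ℝ≥0∞) ^ (d - 1) * μHE[d - 1] B :=
    euclideanHausdorffMeasure_image_le (LipschitzOnWith.of_dist_le_mul fun x hx y hy => by
      rw [dist_eq_norm, dist_eq_norm]; exact (hbd x hx y hy).1) _
  have hH2 : μHE[d - 1] B ≤ (c : ℝ≥0∞) ^ (d - 1) * μHE[d - 1] (π '' B) := by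
    have himg : ψ '' (π '' B) = B := by
      rw [image_image]
      exact (image_congr hψπ).trans (image_id' B)
    have := euclideanHausdorffMeasure_image_le (f := ψ) (s := π '' B) (c := c)
      (LipschitzOnWith.of_dist_le_mul (by
        rintro _ ⟨x, hx, rfl⟩ _ ⟨y, hy, rfl⟩
        rw [dist_eq_norm, dist_eq_norm, hψπ x hx, hψπ y hy]
        exact (hbd x hx y hy).2)) (d - 1)
    rwa [himg] at this
  have hscale : ∀ X : Set (E d), volume ((c : ℝ) • X) = (c : ℝ≥0∞) ^ d * volume X := fun X => by
    rw [Measure.addHaar_smul_of_nonneg _ hc0.le, finrank_euclideanSpace, Fintype.card_fin,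
      ENNReal.ofReal_pow hc0.le, ENNReal.ofReal_coe_nnreal]
  -- If X is obtained from points of Y by radial factors at most c, the cone over X lies in the
  -- c-dilate of the cone over Y.
  have hcone : ∀ X Y : Set (E d), (∀ x ∈ X, ∃ y ∈ Y, ∃ s : ℝ, 0 < s ∧ s ≤ c ∧ x = s • y) →
      volume (Ioc (0 : ℝ) 1 • X) ≤ (c : ℝ≥0∞) ^ d * volume (Ioc (0 : ℝ) 1 • Y) := by
    intro X Y hXY
    rw [← hscale]
    refine measure_mono ?_
    rintro _ ⟨t, ht, x, hx, rfl⟩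
    obtain ⟨y, hy, s, hs0, hsc, rfl⟩ := hXY x hx
    refine ⟨(t * s / c) • y, ⟨t * s / c, ⟨div_pos (mul_pos ht.1 hs0) hc0, ?_⟩, y, hy, rfl⟩, ?_⟩
    · rw [div_le_one hc0]
      exact (mul_le_of_le_one_left hs0.le ht.2).trans hsc
    · simp only [smul_smul]
      rw [mul_div_cancel₀ _ hc0.ne']
  have hV1 : volume (Ioc (0 : ℝ) 1 • B) ≤ (c : ℝ≥0∞) ^ d * volume (Ioc (0 : ℝ) 1 • (π '' B)) :=
    hcone _ _ fun x hx => ⟨π x, ⟨x, hx, rfl⟩, ⟪p, x⟫, hspos x hx, by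
      linarith [(abs_le.1 (hone x hx)).2], by
      rw [hπ, smul_smul, mul_inv_cancel₀ (hspos x hx).ne', one_smul]⟩
  have hV2 : volume (Ioc (0 : ℝ) 1 • (π '' B)) ≤ (c : ℝ≥0∞) ^ d * volume (Ioc (0 : ℝ) 1 • B) :=
    hcone _ _ (by
      rintro _ ⟨x, hx, rfl⟩
      refine ⟨x, hx, ⟪p, x⟫⁻¹, inv_pos.2 (hspos x hx), ?_, rfl⟩
      exact (inv_anti₀ hq (by linarith [(abs_le.1 (hone x hx)).1])).trans hk1)
  have hflatcone := volume_cone_hyperplane hd hp0 hπB hπp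
  have hκ := coneMeasure_apply hP hne hB hsupp h0P
  have hcE : ENNReal.ofReal (c : ℝ) = c := ENNReal.ofReal_coe_nnreal
  have hsurf1 : ENNReal.ofReal ‖p‖⁻¹ * μHE[d - 1] B ≤ c * weightedSurfaceMeasure P B := by
    rw [weightedSurfaceMeasure, withDensity_apply _ hB, ← setLIntegral_const,
      ← lintegral_const_mul' _ _ ENNReal.coe_ne_top]
    refine setLIntegral_mono' hB fun x hx => ?_
    rw [← hcE, ← ENNReal.ofReal_mul hc0.le]
    apply ENNReal.ofReal_le_ofReal
    have hx0 : 0 < ‖gradient (supp P) x‖ := by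
      rw [norm_pos_iff]
      intro h
      have := (hgrad x hx).2
      rw [h, inner_zero_left] at this
      exact zero_ne_one this
    rw [← div_eq_mul_inv, le_div_iff₀ hx0, inv_mul_le_iff₀ hp', mul_comm]
    exact (hratio x hx).1
  have hsurf2 : weightedSurfaceMeasure P B ≤ c * (ENNReal.ofReal ‖p‖⁻¹ * μHE[d - 1] B) := by
    rw [weightedSurfaceMeasure, withDensity_apply _ hB, ← setLIntegral_const,
      ← lintegral_const_mul' _ _ ENNReal.coe_ne_top]
    refine setLIntegral_mono' hB fun x hx => ?_
    rw [← hcE, ← ENNReal.ofReal_mul hc0.le]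
    apply ENNReal.ofReal_le_ofReal
    have hx0 : 0 < ‖gradient (supp P) x‖ := by
      by_contra! h
      have := (hratio x hx).2
      nlinarith
    rw [← div_eq_mul_inv, le_div_iff₀ hp', inv_mul_le_iff₀ hx0, mul_comm]
    exact (hratio x hx).2
  -- The losses are c^d for comparing cones, c^{d-1} for Hausdorff measure under projection, and c
  -- for the norm of the gradient.
  have hpow : (c : ℝ≥0∞) ^ (2 * d) = c ^ d * (c ^ (d - 1) * c) := by
    rw [← pow_succ, Nat.sub_add_cancel hd, ← pow_add, two_mul]
  constructor
  · calc coneMeasure P B = d * volume (Ioc (0 : ℝ) 1 • B) := hκ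
      _ ≤ d * (c ^ d * volume (Ioc (0 : ℝ) 1 • (π '' B))) := by gcongr
      _ = c ^ d * (ENNReal.ofReal ‖p‖⁻¹ * μHE[d - 1] (π '' B)) := by rw [← hflatcone]; ring
      _ ≤ c ^ d * (ENNReal.ofReal ‖p‖⁻¹ * (c ^ (d - 1) * μHE[d - 1] B)) := by gcongr
      _ = c ^ d * (c ^ (d - 1) * (ENNReal.ofReal ‖p‖⁻¹ * μHE[d - 1] B)) := by ring
      _ ≤ c ^ d * (c ^ (d - 1) * (c * weightedSurfaceMeasure P B)) := by gcongr
      _ = _ := by rw [hpow]; ring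
  · calc weightedSurfaceMeasure P B ≤ c * (ENNReal.ofReal ‖p‖⁻¹ * μHE[d - 1] B) := hsurf2
      _ ≤ c * (ENNReal.ofReal ‖p‖⁻¹ * (c ^ (d - 1) * μHE[d - 1] (π '' B))) := by gcongr
      _ = c * c ^ (d - 1) * (d * volume (Ioc (0 : ℝ) 1 • (π '' B))) := by rw [hflatcone]; ring
      _ ≤ c * c ^ (d - 1) * (d * (c ^ d * volume (Ioc (0 : ℝ) 1 • B))) := by gcongr
      _ = _ := by rw [hpow, hκ]; ring

/-- On the smooth part of the level surface, the cone measure is the surface measure weighted by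
the distance of the tangent plane to the origin. -/
lemma coneMeasure_eq_weightedSurfaceMeasure (hd : 0 < d) (hP : IsCompact P)
    (h0 : 0 ∈ interior P) {B : Set (E d)} (hBS : B ⊆ smoothLevel P) (hB : MeasurableSet B) :
    weightedSurfaceMeasure P B = coneMeasure P B := by
  apply le_antisymm
  · refine le_of_forall_one_lt_pow_mul (k := 2 * d) fun c hc => ?_
    obtain ⟨δ, hδ, h⟩ := coneMeasure_locally_close hd hP h0 hc
    exact measure_le_of_locally_le (measurable_gradient (supp P)) hδ
      (fun B hBS hB hx => (h B hBS hB hx).2) hBS hB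
  · refine le_of_forall_one_lt_pow_mul (k := 2 * d) fun c hc => ?_
    obtain ⟨δ, hδ, h⟩ := coneMeasure_locally_close hd hP h0 hc
    exact measure_le_of_locally_le (measurable_gradient (supp P)) hδ
      (fun B hBS hB hx => (h B hBS hB hx).1) hBS hB

/-- Nonzero points projecting outside the smooth part are points of nondifferentiability of h_P, a
null set by Rademacher. -/
lemma coneMeasure_compl_smoothLevel (hd : 0 < d) (hP : IsCompact P) (h0 : 0 ∈ interior P) :
    coneMeasure P (smoothLevel P)ᶜ = 0 := by
  have h0P := interior_subset h0
  have hne : P.Nonempty := ⟨0, h0P⟩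
  have : Nonempty (Fin d) := ⟨⟨0, hd⟩⟩
  have hm := measurable_radialProjection hP hne
  have hS := (measurableSet_smoothLevel hP hne).compl
  rw [coneMeasure, Measure.smul_apply, Measure.map_apply hm hS, smul_eq_mul,
    Measure.restrict_apply (hm hS)]
  refine mul_eq_zero_of_right _ (measure_mono_null (t := {z | z = 0} ∪
    {z | ¬ DifferentiableAt ℝ (supp P) z}) ?_ (measure_union_null (by simp)
    (ae_iff.1 (ae_differentiableAt_supp hP hne))))
  rintro z ⟨hz, -⟩
  by_contra hcon
  rw [mem_union, not_or] at hcon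
  have hz0 : z ≠ 0 := hcon.1
  have hpos := supp_pos hP h0 hz0
  refine hz ⟨?_, ?_⟩
  · rw [supp_smul hP hne (inv_pos.2 hpos).le, inv_mul_cancel₀ hpos.ne']
  · exact differentiableAt_supp_smul hP hne (inv_pos.2 hpos) (not_not.1 hcon.2)

/-- Integration over the smooth part of the level surface `{supp P = 1}` in terms of directions. -/
lemma setLIntegral_smoothLevel (hd : 0 < d) (hP : IsCompact P) (h0 : 0 ∈ interior P)
    {F : E d → ℝ≥0∞} (hF : Measurable F) :
    ∫⁻ x in smoothLevel P, ENNReal.ofReal ‖gradient (supp P) x‖⁻¹ * F x ∂μHE[d - 1] =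
      ∫⁻ φ, F ((supp P φ.1)⁻¹ • φ.1) * ENNReal.ofReal ((supp P φ.1 ^ d)⁻¹)
        ∂(sphereMeasure d) := by
  have h0P := interior_subset h0
  have hne : P.Nonempty := ⟨0, h0P⟩
  have hS := measurableSet_smoothLevel hP hne
  have hm := measurable_radialProjection hP hne
  -- Cone measure has no mass off the smooth part, so the equality there identifies the two
  -- measures.
  have hmeas : (weightedSurfaceMeasure P).restrict (smoothLevel P) = coneMeasure P := by
    ext B hB
    rw [Measure.restrict_apply hB, coneMeasure_eq_weightedSurfaceMeasure hd hP h0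
      inter_subset_right (hB.inter hS), ← measure_inter_add_sdiff B hS,
      measure_mono_null (s := B \ smoothLevel P) (fun x hx => hx.2)
        (coneMeasure_compl_smoothLevel hd hP h0), add_zero]
  have e : ∫⁻ x in smoothLevel P, ENNReal.ofReal ‖gradient (supp P) x‖⁻¹ * F x ∂μHE[d - 1] =
      ∫⁻ x, F x ∂(coneMeasure P) := by
    rw [← hmeas, weightedSurfaceMeasure, restrict_withDensity hS,
      lintegral_withDensity_eq_lintegral_mul _ (measurable_inv_norm_gradient P) hF]
    rfl
  rw [e, coneMeasure, lintegral_smul_measure, lintegral_map hF hm, smul_eq_mul,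
    setLIntegral_homogeneous hd (continuous_supp hP hne).measurable
    (fun w t ht => supp_smul hP hne ht.le w) (fun θ => supp_pos hP h0 (sphere_ne_zero θ))
    (Q := fun z => F ((supp P z)⁻¹ • z)) (hF.comp hm)]
  · intro x t ht
    rw [supp_smul hP hne ht.le, smul_smul, mul_inv, mul_comm t⁻¹, mul_assoc,
      inv_mul_cancel₀ ht.ne', mul_one]

end SurfaceMeasure

/-! ### Duality of the area. -/

section Area

variable {G K : Set (E d)}

lemma measurable_area_integrand (hK : IsCompact K) (hne : K.Nonempty) {P : Set (E d)} :
    Measurable fun q : E d × sphere (0 : E d) 1 =>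
      ENNReal.ofReal |⟪gradient (supp K) q.2.1, gradient (supp P) q.1⟫ - 1| *
        ENNReal.ofReal (((supp K q.2.1 - ⟪q.1, q.2.1⟫) ^ d)⁻¹) := by
  have h1 : Measurable fun q : E d × sphere (0 : E d) 1 =>
      ⟪gradient (supp K) q.2.1, gradient (supp P) q.1⟫ :=
    ((measurable_gradient (supp K)).comp (measurable_subtype_coe.comp measurable_snd)).inner
      ((measurable_gradient (supp P)).comp measurable_fst)
  have h2 : Measurable fun q : E d × sphere (0 : E d) 1 => ⟪q.1, q.2.1⟫ :=
    Continuous.measurable (by fun_prop)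
  have h3 := (continuous_supp hK hne).measurable
  exact ((h1.sub_const 1).abs.ennreal_ofReal).mul (by fun_prop)

/-- The area density of the Funk metric at a smooth boundary point, as an integral over
directions. -/
lemma two_mul_area_polarIn_funkBall (hd : 0 < d) (hG : IsConvexBody G) (hK : IsConvexBody K)
    (h0 : 0 ∈ interior G) (hGK : G ⊆ interior K) {x : E d} (hx : x ∈ smoothBoundary G) :
    2 * μHE[d - 1] (polarIn (tangentSpace G x) (funkBall K x ∩ tangentSpace G x)) =
      ENNReal.ofReal ‖gradient (supp (polarBody G)) x‖⁻¹ *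
      ∫⁻ θ, ENNReal.ofReal |⟪gradient (supp K) θ.1, gradient (supp (polarBody G)) x⟫ - 1| *
        ENNReal.ofReal (((supp K θ.1 - ⟪x, θ.1⟫) ^ d)⁻¹) ∂(sphereMeasure d) := by
  have hcP := isCompact_polarBody hG.isCompact h0
  have hneP : (polarBody G).Nonempty := ⟨0, zero_mem_polarBody G⟩
  have hx' := hx
  rw [smoothBoundary_eq hG h0] at hx'
  obtain ⟨hx1, hxd⟩ := hx'
  have hxK : x ∈ interior K := hGK ((mem_iff_supp_polarBody_le hG h0).2 hx1.le)
  have hne : K.Nonempty := ⟨x, interior_subset hxK⟩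
  set p := gradient (supp (polarBody G)) x with hp
  have hpx : ⟪p, x⟫ = 1 := (inner_gradient_supp hcP hneP hxd).trans hx1
  have hp0 : ‖p‖ ≠ 0 := norm_ne_zero_iff.2 fun h => by simp [h] at hpx
  have hn : ‖outerNormal G x‖ = 1 := by
    rw [outerNormal_eq hG h0 hx, norm_smul, norm_inv, norm_norm, inv_mul_cancel₀ hp0]
  rw [funkBall_eq hK hxK, tangentSpace, two_mul_area_polarIn_section hd
    (isCompact_translate hK.isCompact x) (convex_translate hK.convex x)
    (zero_mem_interior_translate hxK) hn, ← lintegral_const_mul' _ _ ENNReal.ofReal_ne_top]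
  refine lintegral_congr_ae ?_
  filter_upwards [ae_sphere_differentiableAt_supp hK.isCompact hne] with θ hθ
  -- Since ⟪p, x⟫ = 1, pairing ∇h_K(θ) - x with p/‖p‖ gives (⟪∇h_K(θ), p⟫ - 1)/‖p‖; the factor 1/‖p‖
  -- is the weight that turns surface measure into cone measure.
  rw [gradient_supp_translate hK.isCompact hne x hθ, supp_translate hK.isCompact hne,
    outerNormal_eq hG h0 hx, ← hp, real_inner_smul_right, inner_sub_left, real_inner_comm p x,
    hpx, abs_mul, abs_of_nonneg (by positivity), ENNReal.ofReal_mul (by positivity), mul_assoc]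

/-- The Funk Holmes–Thompson area as a double integral over directions. -/
lemma funkArea_eq (hd : 0 < d) (hG : IsConvexBody G) (hK : IsConvexBody K)
    (h0 : 0 ∈ interior G) (hGK : G ⊆ interior K) :
    funkArea K G = (∫⁻ φ, (∫⁻ θ, ENNReal.ofReal
        |⟪gradient (supp K) θ.1, gradient (supp (polarBody G)) φ.1⟫ - 1| *
        ENNReal.ofReal (((supp (polarBody G) φ.1 * supp K θ.1 - ⟪φ.1, θ.1⟫) ^ d)⁻¹)
        ∂(sphereMeasure d)) ∂(sphereMeasure d)) / (2 * unitBallVolume (d - 1)) := by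
  have hcP := isCompact_polarBody hG.isCompact h0
  have hneP : (polarBody G).Nonempty := ⟨0, zero_mem_polarBody G⟩
  have h0P := zero_mem_interior_polarBody hG.isCompact ⟨0, interior_subset h0⟩
  have hne : K.Nonempty := ⟨0, interior_subset (hGK (interior_subset h0))⟩
  have hF := measurable_area_integrand hK.isCompact hne (P := polarBody G)
  have key : ∫⁻ x in smoothBoundary G, 2 * μHE[d - 1] (polarIn (tangentSpace G x)
      (funkBall K x ∩ tangentSpace G x)) ∂μHE[d - 1] =
      ∫⁻ φ, (∫⁻ θ, ENNReal.ofReal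
        |⟪gradient (supp K) θ.1, gradient (supp (polarBody G)) φ.1⟫ - 1| *
        ENNReal.ofReal (((supp (polarBody G) φ.1 * supp K θ.1 - ⟪φ.1, θ.1⟫) ^ d)⁻¹)
        ∂(sphereMeasure d)) ∂(sphereMeasure d) := by
    rw [setLIntegral_congr_fun (measurableSet_smoothBoundary hG h0)
      (fun x hx => two_mul_area_polarIn_funkBall hd hG hK h0 hGK hx), smoothBoundary_eq hG h0]
    refine (setLIntegral_smoothLevel hd hcP h0P hF.lintegral_prod_right').trans ?_
    refine lintegral_congr fun φ => ?_
    have hpos := supp_pos hcP h0P (sphere_ne_zero φ)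
    rw [← lintegral_mul_const' _ _ ENNReal.ofReal_ne_top]
    refine lintegral_congr fun θ => ?_
    simp only
    -- The gradient at φ/h_{G°}(φ) equals that at φ, and the cone-measure factor h_{G°}(φ)^{-d} is
    -- absorbed into the d-th power, clearing its denominator.
    rw [gradient_supp_smul hcP hneP (inv_pos.2 hpos), mul_assoc, mul_comm (ENNReal.ofReal _⁻¹),
      ← ENNReal.ofReal_mul (by positivity), ← mul_inv, ← mul_pow, mul_sub, real_inner_smul_left,
      mul_inv_cancel_left₀ hpos.ne']
  have h2 : (2 : ℝ≥0∞) ≠ 0 := two_ne_zero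
  rw [← key, funkArea, lintegral_const_mul' _ _ (by simp)]
  simp only [areaDensity, ENNReal.div_eq_inv_mul]
  rw [lintegral_const_mul']
  · rw [ENNReal.mul_inv (Or.inl h2) (Or.inl (by simp)), mul_comm (2 : ℝ≥0∞)⁻¹, mul_assoc,
      ← mul_assoc _ (2 : ℝ≥0∞), ENNReal.inv_mul_cancel h2 (by simp), one_mul]
  · rw [ENNReal.inv_ne_top, unitBallVolume]
    exact (Metric.measure_closedBall_pos _ _ one_pos).ne'

/-- Duality of the Funk Holmes–Thompson area. -/
theorem funkArea_duality (hd : 0 < d) (hG : IsConvexBody G) (hK : IsConvexBody K)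
    (h0 : 0 ∈ interior G) (hGK : G ⊆ interior K) :
    funkArea K G = funkArea (polarBody G) (polarBody K) := by
  have h0K : 0 ∈ interior K := hGK (interior_subset h0)
  have hcP := isCompact_polarBody hG.isCompact h0
  have hneP : (polarBody G).Nonempty := ⟨0, zero_mem_polarBody G⟩
  rw [funkArea_eq hd hG hK h0 hGK, funkArea_eq hd (hK.polarBody h0K) (hG.polarBody h0)
    (zero_mem_interior_polarBody hK.isCompact ⟨0, interior_subset h0K⟩)
    (polarBody_subset_interior_polarBody hG hK h0 hGK),
    polarBody_polarBody hK.isCompact.isClosed hK.convex (interior_subset h0K)]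
  congr 1
  -- After exchanging the directions, only the symmetry of the inner product and of multiplication
  -- is needed.
  rw [lintegral_lintegral_swap]
  · refine lintegral_congr fun θ => lintegral_congr fun φ => ?_
    rw [real_inner_comm, real_inner_comm θ.1 φ.1, mul_comm (supp K θ.1)]
  · have h1 := (continuous_supp hcP hneP).measurable
    have h2 := (continuous_supp hK.isCompact ⟨0, interior_subset h0K⟩).measurable
    have h3 : Measurable fun p : sphere (0 : E d) 1 × sphere (0 : E d) 1 => ⟪p.1.1, p.2.1⟫ :=
      Continuous.measurable (by fun_prop)
    have h4 : Measurable fun p : sphere (0 : E d) 1 × sphere (0 : E d) 1 =>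
        ⟪gradient (supp K) p.2.1, gradient (supp (polarBody G)) p.1.1⟫ :=
      ((measurable_gradient (supp K)).comp (measurable_subtype_coe.comp measurable_snd)).inner
        ((measurable_gradient (supp (polarBody G))).comp (measurable_subtype_coe.comp measurable_fst))
    exact (((h4.sub_const 1).abs.ennreal_ofReal).mul (by fun_prop)).aemeasurable

end Area

end HolmesThompson

theorem mainTheorem3 (d : ℕ) (hd : 2 ≤ d) (G K : Set (HolmesThompson.E d))
    (hG : HolmesThompson.IsConvexBody G) (hK : HolmesThompson.IsConvexBody K)
    (hOG : (0 : HolmesThompson.E d) ∈ interior G) (hGK : G ⊆ interior K) :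
    HolmesThompson.funkVolume K G =
        HolmesThompson.funkVolume (HolmesThompson.polarBody G) (HolmesThompson.polarBody K) ∧
      HolmesThompson.funkArea K G =
        HolmesThompson.funkArea (HolmesThompson.polarBody G) (HolmesThompson.polarBody K) := by
  have hd' : 0 < d := by omega
  exact ⟨HolmesThompson.funkVolume_duality hd' hG hK hOG hGK,
    HolmesThompson.funkArea_duality hd' hG hK hOG hGK⟩
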